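/- **Setting.** Let $K\ge 2$ and, for each arm $k\in\{1,\dots,K\}$, let $\Theta_k$ be a set of probability measures on $[0,1]$ that contains all the distributions $p\delta_a+(1-p)\delta_b$ with $p,a,b\in[0,1]$. Put $\Theta=\Theta_1\times\cdots\times\Theta_K$. In the stochastic bandit with environment $\theta=(\nu_1,\dots,\nu_K)\in\Theta$, at each round $t=1,2,\dots,n$ the agent chooses an arm $I_t$ and then observes a reward in $[0,1]$ that is drawn from $\nu_{I_t}$ independently of the past. A policy prescribes the (possibly randomized) choice of $I_t$ as a measurable function of the past decisions and rewards; it may or may not use the number of rounds $n$, and it is called anytime if it does not. Let $\mu_k$ be the mean of $\nu_k$ and $\mu^*=\max_k\mu_k$. The expected regret $\mathbb E_\theta[R_n(A)]$ of a policy $A$ is $n\mu^*$ minus the expected sum of the rewards that $A$ receives in the $n$ rounds. For real $\alpha$, a policy $A$ is $\alpha$-consistent if $\mathbb E_\theta[R_n(A)]=o(n^a)$ for all $a>\alpha$ and all $\theta\in\Theta$; it is consistent if it is $0$-consistent. For $\rho>0$, $\mathrm{UCB}(\rho)$ first draws each arm once (in any order) and then, at each round $t$, draws an arm $k$ that maximizes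 $\hat X_{k}+\sqrt{\rho\log t/T_k(t-1)}$, where $T_k(t-1)$ is the number of times that arm $k$ was drawn in the first $t-1$ rounds and $\hat X_k$ is the empirical mean of the rewards it gave; ties are broken in any way. **Theorem.** 1. Let $\tilde A$ be a consistent policy and let $\rho\in(0,0.4)$. For every policy $A$ there is $\theta\in\Theta$ such that $\min\big(\mathbb E_\theta[R_n(\tilde A)],\mathbb E_\theta[R_n(\mathrm{UCB}(\rho))]\big)>0$ for all large $n$ and $$\limsup_{n\to\infty}\frac{\mathbb E_\theta[R_n(A)]}{\min\big(\mathbb E_\theta[R_n(\tilde A)],\ \mathbb E_\theta[R_n(\mathrm{UCB}(\rho))]\big)}>1 .$$ 2. Consequently, for every $\alpha>0.2$ there is no optimal policy in the class of $\alpha$-consistent policies: for every policy $A$ there are an $\alpha$-consistent (anytime) policy $B$ and an environment $\theta\in\Theta$ such that $\mathbb E_\theta[R_n(B)]\to\infty$ and $$\limsup_{n\to\infty}\frac{\mathbb E_\theta[R_n(A)]}{\mathbb E_\theta[R_n(B)]}>1 .$$ -/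

import Mathlib

open scoped ProbabilityTheory

noncomputable section

namespace Bandit

/-- The interval `[0,1]` in which the rewards lie. -/
abbrev Reward : Type := unitInterval

/-- An environment with `K` arms: the reward distribution of each arm, a probability on `[0,1]`. -/
abbrev Env (K : ℕ) : Type := Fin K → MeasureTheory.ProbabilityMeasure Reward

/-- The past decisions and outcomes after `t` rounds. -/
abbrev Hist (K t : ℕ) : Type := Fin t → Fin K × Reward

/-- The distribution `p δ_a + (1 - p) δ_b`. -/
def twoPoint (p a b : Reward) : MeasureTheory.ProbabilityMeasure Reward :=
  ⟨ENNReal.ofReal (p : ℝ) • MeasureTheory.Measure.dirac a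
      + ENNReal.ofReal (1 - (p : ℝ)) • MeasureTheory.Measure.dirac b, ⟨by
    have hp0 : (0 : ℝ) ≤ p := p.2.1
    have hp1 : (0 : ℝ) ≤ 1 - (p : ℝ) := sub_nonneg.2 p.2.2
    simp [← ENNReal.ofReal_add hp0 hp1]⟩⟩

/-- The set `Θ_1 × ⋯ × Θ_K` of environments. -/
def envSet {K : ℕ} (Θ : Fin K → Set (MeasureTheory.ProbabilityMeasure Reward)) : Set (Env K) :=
  {θ | ∀ k, θ k ∈ Θ k}

/-- A (randomized) policy that does not use the number of rounds. `choose t h` is the law of the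
arm that is drawn at round `t + 1` when `h` is the sequence of the first `t` decisions and
outcomes. Deterministic policies are those whose laws are Dirac measures. -/
structure Policy (K : ℕ) where
  choose : (t : ℕ) → ProbabilityTheory.Kernel (Hist K t) (Fin K)
  markov : ∀ t, ProbabilityTheory.IsMarkovKernel (choose t)

/-- A policy that may use the number of rounds: `A n` is what the agent plays when the game has
`n` rounds (only its first `n` rounds matter). -/
abbrev HorizonPolicy (K : ℕ) : Type := ℕ → Policy K

/-- A policy that ignores the number of rounds, seen as a policy that may use it. -/
def Policy.anytime {K : ℕ} (π : Policy K) : HorizonPolicy K := fun _ => π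

/-- When arm `k` is drawn, the payoff has law `θ k`. -/
def payoff {K : ℕ} (θ : Env K) : ProbabilityTheory.Kernel (Fin K) Reward :=
  ⟨fun k => (θ k : MeasureTheory.Measure Reward), measurable_of_countable _⟩

/-- One round, given the past: the arm is drawn from the policy, then the payoff is drawn from the
distribution of this arm, independently of the past. -/
def step {K : ℕ} (π : Policy K) (θ : Env K) (t : ℕ) :
    ProbabilityTheory.Kernel (Hist K t) (Fin K × Reward) :=
  π.choose t ⊗ₖ ProbabilityTheory.Kernel.prodMkLeft (Hist K t) (payoff θ)

/-- The law of the first `t` decisions and outcomes of policy `π` in environment `θ`. -/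
def histLaw {K : ℕ} (π : Policy K) (θ : Env K) : (t : ℕ) → MeasureTheory.Measure (Hist K t)
  | 0 => MeasureTheory.Measure.dirac Fin.elim0
  | t + 1 => ((histLaw π θ t).compProd (step π θ t)).map
      (fun x => (Fin.snoc x.1 x.2 : Hist K (t + 1)))

instance {K : ℕ} (θ : Env K) : ProbabilityTheory.IsMarkovKernel (payoff θ) :=
  ⟨fun k => (θ k).2⟩

instance {K : ℕ} (π : Policy K) (θ : Env K) (t : ℕ) :
    ProbabilityTheory.IsMarkovKernel (step π θ t) := by
  have := π.markov t
  unfold step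
  infer_instance

theorem measurable_snoc (K t : ℕ) :
    Measurable (fun x : Hist K t × (Fin K × Reward) => (Fin.snoc x.1 x.2 : Hist K (t + 1))) := by
  refine measurable_pi_iff.2 (Fin.lastCases ?_ fun i => ?_)
  · simpa using measurable_snd
  · simp only [Fin.snoc_castSucc]
    exact (measurable_pi_apply i).comp measurable_fst

instance {K : ℕ} (π : Policy K) (θ : Env K) (t : ℕ) :
    MeasureTheory.IsProbabilityMeasure (histLaw π θ t) := by
  induction t with
  | zero => unfold histLaw; infer_instance
  | succ t ih =>
    unfold histLaw
    exact MeasureTheory.Measure.isProbabilityMeasure_map (measurable_snoc K t).aemeasurable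

/-- The mean reward of an arm. -/
def mean (ν : MeasureTheory.ProbabilityMeasure Reward) : ℝ :=
  ∫ x : Reward, (x : ℝ) ∂(ν : MeasureTheory.Measure Reward)

/-- The mean reward of a best arm. -/
def bestMean {K : ℕ} (θ : Env K) : ℝ := ⨆ k, mean (θ k)

/-- The expected regret in a game with `n` rounds: the expected cumulative reward of always drawing
a best arm, minus the expected cumulative reward that the agent actually receives. -/
def expRegret {K : ℕ} (A : HorizonPolicy K) (θ : Env K) (n : ℕ) : ℝ :=
  n * bestMean θ - ∫ h, ∑ s : Fin n, ((h s).2 : ℝ) ∂(histLaw (A n) θ n)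

/-- `α`-consistency: for all `a > α` and all environments, the expected regret is `o(n ^ a)`. -/
def IsAlphaConsistent {K : ℕ} (Θ : Fin K → Set (MeasureTheory.ProbabilityMeasure Reward)) (α : ℝ)
    (A : HorizonPolicy K) : Prop :=
  ∀ a : ℝ, α < a → ∀ θ ∈ envSet Θ,
    Asymptotics.IsLittleO Filter.atTop (fun n : ℕ => expRegret A θ n) (fun n : ℕ => (n : ℝ) ^ a)

/-- Consistency: for all `a > 0` and all environments, the expected regret is `o(n ^ a)`. -/
def IsConsistent {K : ℕ} (Θ : Fin K → Set (MeasureTheory.ProbabilityMeasure Reward))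
    (A : HorizonPolicy K) : Prop :=
  ∀ a : ℝ, 0 < a → ∀ θ ∈ envSet Θ,
    Asymptotics.IsLittleO Filter.atTop (fun n : ℕ => expRegret A θ n) (fun n : ℕ => (n : ℝ) ^ a)

/-- The number of times that arm `k` has been drawn. -/
def pulls {K t : ℕ} (h : Hist K t) (k : Fin K) : ℕ :=
  (Finset.univ.filter fun s => (h s).1 = k).card

/-- The empirical mean of the rewards of arm `k`. -/
def empMean {K t : ℕ} (h : Hist K t) (k : Fin K) : ℝ :=
  (∑ s ∈ Finset.univ.filter (fun s => (h s).1 = k), ((h s).2 : ℝ)) / pulls h k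

/-- The index of arm `k` at round `t + 1`, given the first `t` decisions and outcomes. -/
def ucbIndex (ρ : ℝ) {K t : ℕ} (h : Hist K t) (k : Fin K) : ℝ :=
  empMean h k + Real.sqrt (ρ * Real.log ((t : ℝ) + 1) / pulls h k)

/-- `π` is a version of UCB(`ρ`): it first draws each arm once (in any order), then at each round an
arm of maximal index (with any rule to break ties). -/
def IsUCB (ρ : ℝ) {K : ℕ} (π : Policy K) : Prop :=
  ∀ (t : ℕ) (h : Hist K t), ∀ᵐ k ∂(π.choose t h),
    ((∃ j, pulls h j = 0) → pulls h k = 0) ∧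
    ((∀ j, pulls h j ≠ 0) → ∀ j, ucbIndex ρ h j ≤ ucbIndex ρ h k)

end Bandit

end

noncomputable section

open scoped ProbabilityTheory ENNReal
open MeasureTheory ProbabilityTheory Filter

namespace Bandit

variable {K : ℕ}

/-! ### Integration against the law of the history -/

/-! Everything turns on the environment `pointEnv i a` with a = 0.7: arm i always pays a, the other
arms always pay 0. Turning an arm k ≠ i into p δ_0 + (1-p) δ_1 with 1 - p > a makes it the best arm,
yet T pulls of it hide the change with probability p^T. Hence a policy with regret o(n^b) for all b
> α in every environment must, in `pointEnv i a`, pull each such arm about (1-α) log n / L times at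
least, where L = -log(1-a). This is `exists_one_lt_mul_le_expRegret_pointEnv`; it rests on the
one-sided change of measure `lintegral_prod_weight_mul_le`.

Part 1 is a dichotomy. If A is consistent, it loses to UCB(ρ) in `pointEnv i a`, where UCB(ρ) pulls
a bad arm at most (ρ/a²) log n + 1 times and ρ/a² < 1/L because ρ < 0.4. If A is not consistent, its
regret fails to be o(n^b) in some environment for some b > 0, and there it loses to the consistent
policy.

Part 2 uses the same dichotomy with 0 < γ < β < min(α, 1), and `explorePolicy` instead of the two
competitors; this gives every α > 0. While the rewards look like those of `pointEnv i a`, this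
policy explores the arms other than i only (1-β) log t / L times, which by
`exists_measure_exploits_le` is still enough to keep the regret O(n^β) everywhere. If A achieves the
exponent γ, its lower bound (1-γ)/L exceeds (1-β)/L in `pointEnv i a`; otherwise the version of
`explorePolicy` with exponent γ wins wherever A fails. -/

theorem lintegral_step (π : Policy K) (θ : Env K) (t : ℕ) (h : Hist K t)
    {g : Fin K × Reward → ℝ≥0∞} (hg : Measurable g) :
    ∫⁻ y, g y ∂(step π θ t h) =
      ∫⁻ k, ∫⁻ x, g (k, x) ∂(θ k : Measure Reward) ∂(π.choose t h) := by
  have := π.markov t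
  rw [step, Kernel.lintegral_compProd _ _ _ hg]
  rfl

theorem lintegral_histLaw_succ (π : Policy K) (θ : Env K) (t : ℕ)
    {f : Hist K (t + 1) → ℝ≥0∞} (hf : Measurable f) :
    ∫⁻ h, f h ∂(histLaw π θ (t + 1)) =
      ∫⁻ h, ∫⁻ y, f (Fin.snoc h y) ∂(step π θ t h) ∂(histLaw π θ t) := by
  rw [histLaw, lintegral_map hf (measurable_snoc K t),
    Measure.lintegral_compProd (f := fun x => f (Fin.snoc x.1 x.2))
      (hf.comp (measurable_snoc K t))]

theorem ae_histLaw_succ (π : Policy K) (θ : Env K) (t : ℕ) {P : Hist K (t + 1) → Prop}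
    (hP : MeasurableSet {h | P h})
    (H : ∀ᵐ h ∂(histLaw π θ t), ∀ᵐ k ∂(π.choose t h), ∀ᵐ x ∂(θ k : Measure Reward),
      P (Fin.snoc h (k, x))) :
    ∀ᵐ h ∂(histLaw π θ (t + 1)), P h := by
  have hf : Measurable ({h | P h}ᶜ.indicator (1 : Hist K (t + 1) → ℝ≥0∞)) :=
    measurable_one.indicator hP.compl
  rw [ae_iff]
  change histLaw π θ (t + 1) {h | P h}ᶜ = 0
  rw [← lintegral_indicator_one hP.compl, lintegral_histLaw_succ π θ t hf,
    lintegral_eq_zero_iff' ]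
  · filter_upwards [H] with h hh
    rw [lintegral_step π θ t h (g := fun y => {h | P h}ᶜ.indicator 1 (Fin.snoc h y))
      (hf.comp ((measurable_snoc K t).comp measurable_prodMk_left)),
      Pi.zero_apply, ← lintegral_zero (μ := π.choose t h)]
    refine lintegral_congr_ae ?_
    filter_upwards [hh] with k hk
    rw [← lintegral_zero (μ := (θ k : Measure Reward))]
    refine lintegral_congr_ae ?_
    filter_upwards [hk] with x hx
    simp [hx]
  · exact (Measurable.lintegral_kernel_prod_right'
      (hf.comp (measurable_snoc K t))).aemeasurable

theorem measurable_arm {t : ℕ} (s : Fin t) : Measurable fun h : Hist K t => (h s).1 :=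
  measurable_fst.comp (measurable_pi_apply s)

theorem measurable_reward {t : ℕ} (s : Fin t) : Measurable fun h : Hist K t => (h s).2 :=
  measurable_snd.comp (measurable_pi_apply s)

theorem measurableSet_arm_eq {t : ℕ} (s : Fin t) (j : Fin K) :
    MeasurableSet {h : Hist K t | (h s).1 = j} :=
  measurable_arm s (measurableSet_singleton j)

/-! ### Numbers of pulls and sums of rewards -/

theorem pulls_eq_sum {t : ℕ} (h : Hist K t) (k : Fin K) :
    pulls h k = ∑ s, if (h s).1 = k then 1 else 0 := by
  simp [pulls]

theorem pulls_zero (h : Hist K 0) (k : Fin K) : pulls h k = 0 := by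
  simp [pulls]

theorem pulls_snoc {t : ℕ} (h : Hist K t) (k j : Fin K) (x : Reward) :
    pulls (Fin.snoc h (k, x) : Hist K (t + 1)) j = pulls h j + if k = j then 1 else 0 := by
  simp only [pulls_eq_sum, Fin.sum_univ_castSucc, Fin.snoc_castSucc, Fin.snoc_last]

theorem sum_pulls {t : ℕ} (h : Hist K t) : ∑ k, pulls h k = t := by
  simp only [pulls_eq_sum]
  rw [Finset.sum_comm]
  simp

theorem pulls_le {t : ℕ} (h : Hist K t) (k : Fin K) : pulls h k ≤ t := by
  exact (Finset.single_le_sum (f := pulls h) (fun _ _ => Nat.zero_le _)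
    (Finset.mem_univ k)).trans_eq (sum_pulls h)

theorem measurable_pulls {t : ℕ} (k : Fin K) : Measurable fun h : Hist K t => pulls h k := by
  simp only [pulls_eq_sum]
  exact Finset.measurable_sum _ fun s _ =>
    Measurable.ite (measurableSet_arm_eq s k) measurable_const measurable_const

/-- The sum of the rewards of arm `k`. -/
def rewardSum {t : ℕ} (h : Hist K t) (k : Fin K) : ℝ :=
  ∑ s, if (h s).1 = k then ((h s).2 : ℝ) else 0

theorem empMean_eq {t : ℕ} (h : Hist K t) (k : Fin K) :
    empMean h k = rewardSum h k / pulls h k := by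
  rw [empMean, rewardSum, Finset.sum_filter]

theorem measurable_rewardSum {t : ℕ} (k : Fin K) :
    Measurable fun h : Hist K t => rewardSum h k := by
  unfold rewardSum
  exact Finset.measurable_sum _ fun s _ => Measurable.ite (measurableSet_arm_eq s k)
    (measurable_subtype_coe.comp (measurable_reward s)) measurable_const

theorem measurable_empMean {t : ℕ} (k : Fin K) :
    Measurable fun h : Hist K t => empMean h k := by
  simp only [empMean_eq]
  exact (measurable_rewardSum k).div (measurable_from_top.comp (measurable_pulls k))

/-- The expected number of pulls of arm `k` in `t` rounds. -/
def expPulls (π : Policy K) (θ : Env K) (t : ℕ) (k : Fin K) : ℝ :=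
  ∫ h, (pulls h k : ℝ) ∂(histLaw π θ t)

theorem measurable_pulls_real {t : ℕ} (k : Fin K) :
    Measurable fun h : Hist K t => (pulls h k : ℝ) :=
  measurable_from_top.comp (measurable_pulls k)

theorem integrable_of_bound {π : Policy K} {θ : Env K} {t : ℕ} {f : Hist K t → ℝ}
    (hf : Measurable f) (C : ℝ) (hC : ∀ h, |f h| ≤ C) : Integrable f (histLaw π θ t) :=
  Integrable.of_bound hf.aestronglyMeasurable C (Eventually.of_forall hC)

theorem integrable_pulls (π : Policy K) (θ : Env K) (t : ℕ) (k : Fin K) :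
    Integrable (fun h => (pulls h k : ℝ)) (histLaw π θ t) :=
  integrable_of_bound (measurable_pulls_real k) t fun h => by
    rw [abs_of_nonneg (Nat.cast_nonneg _)]
    exact_mod_cast pulls_le h k

theorem expPulls_nonneg (π : Policy K) (θ : Env K) (t : ℕ) (k : Fin K) :
    0 ≤ expPulls π θ t k :=
  integral_nonneg fun _ => Nat.cast_nonneg _

theorem sum_expPulls (π : Policy K) (θ : Env K) (t : ℕ) :
    ∑ k, expPulls π θ t k = t := by
  unfold expPulls
  rw [← integral_finsetSum _ fun k _ => integrable_pulls π θ t k]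
  have : ∀ h : Hist K t, ∑ k, (pulls h k : ℝ) = t := fun h => by exact_mod_cast sum_pulls h
  simp [this]

theorem ofReal_expPulls (π : Policy K) (θ : Env K) (t : ℕ) (k : Fin K) :
    ENNReal.ofReal (expPulls π θ t k) = ∫⁻ h, (pulls h k : ℝ≥0∞) ∂(histLaw π θ t) := by
  rw [expPulls, ofReal_integral_eq_lintegral_ofReal (integrable_pulls π θ t k)
    (Eventually.of_forall fun _ => Nat.cast_nonneg _)]
  simp

theorem expPulls_le_of_ae {π : Policy K} {θ : Env K} {t : ℕ} {k : Fin K} {c : ℝ}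
    (H : ∀ᵐ h ∂(histLaw π θ t), (pulls h k : ℝ) ≤ c) : expPulls π θ t k ≤ c := by
  have := integral_mono_ae (integrable_pulls π θ t k) (integrable_const c) H
  simpa [expPulls] using this

theorem le_expPulls_of_ae {π : Policy K} {θ : Env K} {t : ℕ} {k : Fin K} {c : ℝ}
    (H : ∀ᵐ h ∂(histLaw π θ t), c ≤ (pulls h k : ℝ)) : c ≤ expPulls π θ t k := by
  have := integral_mono_ae (integrable_const c) (integrable_pulls π θ t k) H
  simpa [expPulls] using this

/-! ### Regret -/

theorem mean_nonneg (ν : ProbabilityMeasure Reward) : 0 ≤ mean ν :=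
  integral_nonneg fun x => x.2.1

theorem integrable_reward (ν : ProbabilityMeasure Reward) :
    Integrable (fun x : Reward => (x : ℝ)) (ν : Measure Reward) :=
  Integrable.of_bound measurable_subtype_coe.aestronglyMeasurable 1
    (Eventually.of_forall fun x => by
      rw [Real.norm_eq_abs, abs_of_nonneg x.2.1]; exact x.2.2)

theorem ofReal_mean (ν : ProbabilityMeasure Reward) :
    ENNReal.ofReal (mean ν) = ∫⁻ x : Reward, ENNReal.ofReal (x : ℝ) ∂(ν : Measure Reward) := by
  rw [mean, ofReal_integral_eq_lintegral_ofReal (integrable_reward ν)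
    (Eventually.of_forall fun x => x.2.1)]

theorem mean_le_bestMean (θ : Env K) (k : Fin K) : mean (θ k) ≤ bestMean θ :=
  le_ciSup (f := fun k => mean (θ k)) (Set.finite_range _).bddAbove k

theorem exists_mean_eq_bestMean [Nonempty (Fin K)] (θ : Env K) :
    ∃ k, mean (θ k) = bestMean θ :=
  exists_eq_ciSup_of_finite (f := fun k => mean (θ k))

/-- Given the past and the arm, a reward may be replaced by its mean. Working in `ℝ≥0∞` keeps
integrability out of the induction. -/
theorem lintegral_sum_reward (π : Policy K) (θ : Env K) (t : ℕ) :
    ∫⁻ h, ∑ s, ENNReal.ofReal ((h s).2 : ℝ) ∂(histLaw π θ t) =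
      ∫⁻ h, ∑ s, ENNReal.ofReal (mean (θ (h s).1)) ∂(histLaw π θ t) := by
  have m1 : ∀ t, Measurable fun h : Hist K t => ∑ s, ENNReal.ofReal ((h s).2 : ℝ) := fun t =>
    Finset.measurable_sum _ fun s _ =>
      (measurable_subtype_coe.comp (measurable_reward s)).ennreal_ofReal
  have m2 : ∀ t, Measurable fun h : Hist K t => ∑ s, ENNReal.ofReal (mean (θ (h s).1)) :=
    fun t => Finset.measurable_sum _ fun s _ =>
      (measurable_of_countable fun k => ENNReal.ofReal (mean (θ k))).comp (measurable_arm s)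
  have m3 : Measurable fun y : Fin K × Reward => ENNReal.ofReal (y.2 : ℝ) :=
    (measurable_subtype_coe.comp measurable_snd).ennreal_ofReal
  have m4 : Measurable fun y : Fin K × Reward => ENNReal.ofReal (mean (θ y.1)) :=
    (measurable_of_countable fun k => ENNReal.ofReal (mean (θ k))).comp measurable_fst
  induction t with
  | zero => simp
  | succ t ih =>
    rw [lintegral_histLaw_succ π θ t (m1 _), lintegral_histLaw_succ π θ t (m2 _)]
    simp only [Fin.sum_univ_castSucc, Fin.snoc_castSucc, Fin.snoc_last]
    have e1 : ∀ h : Hist K t, ∫⁻ y, (∑ s, ENNReal.ofReal ((h s).2 : ℝ)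
        + ENNReal.ofReal (y.2 : ℝ)) ∂(step π θ t h) = ∑ s, ENNReal.ofReal ((h s).2 : ℝ)
          + ∫⁻ k, ENNReal.ofReal (mean (θ k)) ∂(π.choose t h) := fun h => by
      rw [lintegral_add_left measurable_const, lintegral_step π θ t h m3]
      simp [ofReal_mean]
    have e2 : ∀ h : Hist K t, ∫⁻ y, (∑ s, ENNReal.ofReal (mean (θ (h s).1))
        + ENNReal.ofReal (mean (θ y.1))) ∂(step π θ t h) =
          ∑ s, ENNReal.ofReal (mean (θ (h s).1))
          + ∫⁻ k, ENNReal.ofReal (mean (θ k)) ∂(π.choose t h) := fun h => by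
      rw [lintegral_add_left measurable_const, lintegral_step π θ t h m4]
      simp
    simp only [e1, e2]
    rw [lintegral_add_left (m1 t), lintegral_add_left (m2 t), ih]

theorem sum_mean_eq {t : ℕ} (θ : Env K) (h : Hist K t) :
    ∑ s, mean (θ (h s).1) = ∑ k, mean (θ k) * pulls h k := by
  simp only [pulls_eq_sum, Nat.cast_sum, Nat.cast_ite, Nat.cast_one, Nat.cast_zero,
    Finset.mul_sum]
  rw [Finset.sum_comm]
  simp

theorem integral_sum_reward (π : Policy K) (θ : Env K) (t : ℕ) :
    ∫ h, ∑ s : Fin t, ((h s).2 : ℝ) ∂(histLaw π θ t) =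
      ∑ k, mean (θ k) * expPulls π θ t k := by
  have h1 : ∫ h, ∑ s : Fin t, ((h s).2 : ℝ) ∂(histLaw π θ t) =
      ∫ h, ∑ s : Fin t, mean (θ (h s).1) ∂(histLaw π θ t) := by
    rw [integral_eq_lintegral_of_nonneg_ae, integral_eq_lintegral_of_nonneg_ae]
    · congr 1
      have := lintegral_sum_reward π θ t
      simp only [← ENNReal.ofReal_sum_of_nonneg (fun (s : Fin t) _ => mean_nonneg (θ _))] at this
      rw [← this]
      refine lintegral_congr fun h => ?_
      rw [ENNReal.ofReal_sum_of_nonneg fun s _ => (h s).2.2.1]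
    · exact Eventually.of_forall fun h => Finset.sum_nonneg fun s _ => mean_nonneg _
    · exact (Finset.measurable_sum _ fun s _ =>
        (measurable_of_countable fun k => mean (θ k)).comp
          (measurable_arm s)).aestronglyMeasurable
    · exact Eventually.of_forall fun h => Finset.sum_nonneg fun s _ => (h s).2.2.1
    · exact (Finset.measurable_sum _ fun s _ =>
        measurable_subtype_coe.comp (measurable_reward s)).aestronglyMeasurable
  rw [h1]
  simp only [sum_mean_eq]
  rw [integral_finsetSum _ fun k _ => (integrable_pulls π θ t k).const_mul _]
  simp only [integral_const_mul, expPulls]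

theorem expRegret_eq (A : HorizonPolicy K) (θ : Env K) (n : ℕ) :
    expRegret A θ n = ∑ k, (bestMean θ - mean (θ k)) * expPulls (A n) θ n k := by
  rw [expRegret, integral_sum_reward]
  simp only [sub_mul, Finset.sum_sub_distrib, ← Finset.mul_sum, sum_expPulls]
  ring

theorem expRegret_nonneg (A : HorizonPolicy K) (θ : Env K) (n : ℕ) : 0 ≤ expRegret A θ n := by
  rw [expRegret_eq]
  exact Finset.sum_nonneg fun k _ =>
    mul_nonneg (sub_nonneg.2 (mean_le_bestMean θ k)) (expPulls_nonneg _ _ _ _)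

theorem gap_mul_expPulls_le (A : HorizonPolicy K) (θ : Env K) (n : ℕ) (k : Fin K) :
    (bestMean θ - mean (θ k)) * expPulls (A n) θ n k ≤ expRegret A θ n := by
  rw [expRegret_eq]
  exact Finset.single_le_sum (f := fun k => (bestMean θ - mean (θ k)) * expPulls (A n) θ n k)
    (fun k _ => mul_nonneg (sub_nonneg.2 (mean_le_bestMean θ k)) (expPulls_nonneg _ _ _ _))
    (Finset.mem_univ k)

/-- If arm `k` beats the other arms by at least `d`, every other pull costs at least `d`. -/
theorem mul_sub_expPulls_le (A : HorizonPolicy K) (θ : Env K) (n : ℕ) (k : Fin K) {d : ℝ}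
    (hd : ∀ j, j ≠ k → mean (θ j) + d ≤ mean (θ k)) :
    d * (n - expPulls (A n) θ n k) ≤ expRegret A θ n := by
  rw [expRegret_eq, ← sum_expPulls (A n) θ n,
    ← Finset.add_sum_erase Finset.univ (expPulls (A n) θ n) (Finset.mem_univ k),
    add_sub_cancel_left, Finset.mul_sum,
    ← Finset.add_sum_erase Finset.univ (fun k => (bestMean θ - mean (θ k)) * _)
      (Finset.mem_univ k)]
  refine le_add_of_nonneg_of_le (mul_nonneg (sub_nonneg.2 (mean_le_bestMean θ k))
    (expPulls_nonneg _ _ _ _)) (Finset.sum_le_sum fun j hj => ?_)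
  have := hd j (Finset.ne_of_mem_erase hj)
  have := mean_le_bestMean θ k
  exact mul_le_mul_of_nonneg_right (by linarith) (expPulls_nonneg _ _ _ _)

/-! ### Change of measure -/

/-- The likelihood ratio is a product over the rounds, in which the policy's own choices cancel;
only a lower bound on each factor is kept. Neither absolute continuity nor a divergence is involved,
and a weight may be 0. -/
theorem lintegral_prod_weight_mul_le (π : Policy K) {θ θ' : Env K} (w : Fin K → ℝ≥0∞)
    (hw : ∀ j, w j • (θ j : Measure Reward) ≤ (θ' j : Measure Reward)) (t : ℕ)
    {f : Hist K t → ℝ≥0∞} (hf : Measurable f) :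
    ∫⁻ h, (∏ s, w (h s).1) * f h ∂(histLaw π θ t) ≤ ∫⁻ h, f h ∂(histLaw π θ' t) := by
  have mw : ∀ t, Measurable fun h : Hist K t => ∏ s, w (h s).1 := fun t =>
    Finset.measurable_prod _ fun s _ => (measurable_of_countable w).comp (measurable_arm s)
  induction t with
  | zero => simp [histLaw]
  | succ t ih =>
    have ms : ∀ h : Hist K t, Measurable fun y => f (Fin.snoc h y) := fun h =>
      hf.comp ((measurable_snoc K t).comp measurable_prodMk_left)
    rw [lintegral_histLaw_succ π θ' t hf, lintegral_histLaw_succ π θ t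
      (f := fun h => (∏ s, w (h s).1) * f h) ((mw _).mul hf)]
    refine le_trans (lintegral_mono fun h => ?_)
      (ih (Measurable.lintegral_kernel_prod_right' (hf.comp (measurable_snoc K t))))
    simp only [Fin.prod_univ_castSucc, Fin.snoc_castSucc, Fin.snoc_last, mul_assoc]
    have mh : Measurable fun y : Fin K × Reward => w y.1 * f (Fin.snoc h y) :=
      ((measurable_of_countable w).comp measurable_fst).mul (ms h)
    rw [lintegral_const_mul _ mh, lintegral_step π θ t h mh]
    change _ ≤ _ * ∫⁻ y, f (Fin.snoc h y) ∂(step π θ' t h)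
    rw [lintegral_step π θ' t h (ms h)]
    refine mul_le_mul' le_rfl (lintegral_mono fun k => ?_)
    have := lintegral_mono' (hw k) (le_refl fun x => f (Fin.snoc h (k, x)))
    rw [lintegral_smul_measure] at this
    exact (lintegral_const_mul _ ((ms h).comp measurable_prodMk_left)).trans_le this

/-- Change of the reward distribution of a single arm. -/
theorem lintegral_pow_pulls_mul_le (π : Policy K) (θ : Env K) (k : Fin K)
    (ν : ProbabilityMeasure Reward) (w : ℝ≥0∞)
    (hw : w • (θ k : Measure Reward) ≤ (ν : Measure Reward)) (t : ℕ)
    {f : Hist K t → ℝ≥0∞} (hf : Measurable f) :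
    ∫⁻ h, w ^ pulls h k * f h ∂(histLaw π θ t) ≤
      ∫⁻ h, f h ∂(histLaw π (Function.update θ k ν) t) := by
  have := lintegral_prod_weight_mul_le π (θ := θ) (θ' := Function.update θ k ν)
    (fun j => if j = k then w else 1) (fun j => ?_) t hf
  · refine le_of_eq_of_le (lintegral_congr fun h => ?_) this
    simp [Finset.prod_ite, pulls]
  · by_cases hj : j = k
    · subst hj; simpa using hw
    · simp [hj]

/-! ### Deviation inequalities -/

/-- The product is a supermartingale: given the past, the last factor has mean at most 1 whichever
arm is drawn. -/
theorem lintegral_prod_reward_le_one (π : Policy K) (θ : Env K) (j : Fin K)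
    {w : Reward → ℝ≥0∞} (hw : Measurable w) (hw1 : ∫⁻ x, w x ∂(θ j : Measure Reward) ≤ 1)
    (t : ℕ) :
    ∫⁻ h, ∏ s, (if (h s).1 = j then w (h s).2 else 1) ∂(histLaw π θ t) ≤ 1 := by
  have mw : ∀ t, Measurable fun h : Hist K t => ∏ s, (if (h s).1 = j then w (h s).2 else 1) :=
    fun t => Finset.measurable_prod _ fun s _ =>
      Measurable.ite (measurableSet_arm_eq s j) (hw.comp (measurable_reward s)) measurable_const
  have m2 : Measurable fun y : Fin K × Reward => if y.1 = j then w y.2 else 1 :=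
    Measurable.ite (measurable_fst (measurableSet_singleton j)) (hw.comp measurable_snd)
      measurable_const
  induction t with
  | zero => simp
  | succ t ih =>
    rw [lintegral_histLaw_succ π θ t (mw _)]
    refine le_trans (lintegral_mono fun h => ?_) ih
    simp only [Fin.prod_univ_castSucc, Fin.snoc_castSucc, Fin.snoc_last]
    rw [lintegral_const_mul _ m2, lintegral_step π θ t h m2]
    refine mul_le_of_le_one_right zero_le ?_
    have := π.markov t
    calc ∫⁻ k, ∫⁻ x, (if k = j then w x else 1) ∂(θ k : Measure Reward) ∂(π.choose t h)
        ≤ ∫⁻ _, 1 ∂(π.choose t h) := lintegral_mono fun k => by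
          by_cases hk : k = j
          · subst hk; simpa using hw1
          · simp [hk]
      _ ≤ 1 := by simp

/-- Markov's inequality for this supermartingale. As the number of pulls is random, this replaces a
union bound over its values. -/
theorem measure_le_of_one_le_mul_prod (π : Policy K) (θ : Env K) (j : Fin K)
    {w : Reward → ℝ≥0∞} (hw : Measurable w) (hw1 : ∫⁻ x, w x ∂(θ j : Measure Reward) ≤ 1)
    {t : ℕ} (c : ℝ≥0∞) (E : Set (Hist K t))
    (hE : ∀ h ∈ E, 1 ≤ c * ∏ s, (if (h s).1 = j then w (h s).2 else 1)) :
    histLaw π θ t E ≤ c := by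
  have mw : Measurable fun h : Hist K t => ∏ s, (if (h s).1 = j then w (h s).2 else 1) :=
    Finset.measurable_prod _ fun s _ =>
      Measurable.ite (measurableSet_arm_eq s j) (hw.comp (measurable_reward s)) measurable_const
  calc histLaw π θ t E ≤ histLaw π θ t
        {h | 1 ≤ c * ∏ s, (if (h s).1 = j then w (h s).2 else 1)} := measure_mono hE
    _ ≤ ∫⁻ h, c * ∏ s, (if (h s).1 = j then w (h s).2 else 1) ∂(histLaw π θ t) := by
        simpa using mul_meas_ge_le_lintegral (μ := histLaw π θ t) (mw.const_mul c) 1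
    _ ≤ c := by
        rw [lintegral_const_mul _ mw]
        exact mul_le_of_le_one_right zero_le (lintegral_prod_reward_le_one π θ j hw hw1 t)

/-- Only the rewards `a` are seen on `m` pulls with probability at most `r ^ m`, if `a` has
probability at most `r`. -/
theorem measure_all_rewards_eq_le (π : Policy K) (θ : Env K) (j : Fin K) (a : Reward) {r : ℝ}
    (hr0 : 0 < r) (hr1 : r ≤ 1) (hr : (θ j : Measure Reward) {a} ≤ ENNReal.ofReal r)
    (t : ℕ) (m : ℝ) :
    histLaw π θ t {h | m ≤ pulls h j ∧ ∀ s, (h s).1 = j → (h s).2 = a} ≤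
      ENNReal.ofReal (r ^ m) := by
  have h0 : ENNReal.ofReal r ≠ 0 := by simpa using hr0
  refine measure_le_of_one_le_mul_prod π θ j
    (w := fun x => (ENNReal.ofReal r)⁻¹ * ({a} : Set Reward).indicator 1 x)
    ((measurable_one.indicator (measurableSet_singleton a)).const_mul _) ?_ _ _ ?_
  · rw [lintegral_const_mul _ (measurable_one.indicator (measurableSet_singleton a)),
      lintegral_indicator_one (measurableSet_singleton a)]
    calc _ ≤ (ENNReal.ofReal r)⁻¹ * ENNReal.ofReal r := by gcongr
      _ = 1 := ENNReal.inv_mul_cancel h0 ENNReal.ofReal_ne_top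
  · rintro h ⟨hm, ha⟩
    have : ∏ s, (if (h s).1 = j then
        (ENNReal.ofReal r)⁻¹ * ({a} : Set Reward).indicator 1 (h s).2 else 1) =
        (ENNReal.ofReal r)⁻¹ ^ pulls h j := by
      rw [pulls, ← Finset.prod_const, Finset.prod_filter]
      refine Finset.prod_congr rfl fun s _ => ?_
      by_cases hs : (h s).1 = j
      · simp [hs, ha s hs]
      · simp [hs]
    rw [this, ← ENNReal.inv_pow, ← div_eq_mul_inv, ENNReal.le_div_iff_mul_le
      (Or.inl (pow_ne_zero _ h0)) (Or.inl (ENNReal.pow_ne_top ENNReal.ofReal_ne_top)), one_mul,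
      ← ENNReal.ofReal_pow hr0.le, ← Real.rpow_natCast]
    exact ENNReal.ofReal_le_ofReal (Real.rpow_le_rpow_of_exponent_ge hr0 hr1 hm)

/-- Hoeffding's lemma on an interval of length 1 (variance proxy 1/4), at the parameter 4d: the
moment generating function is at most exp(2d²). -/
theorem lintegral_exp_le_one (ν : ProbabilityMeasure Reward) (d : ℝ) :
    ∫⁻ x : Reward, ENNReal.ofReal (Real.exp (4 * d * (x - mean ν) - 2 * d ^ 2))
      ∂(ν : Measure Reward) ≤ 1 := by
  have H := hasSubgaussianMGF_of_mem_Icc (μ := (ν : Measure Reward)) (a := 0) (b := 1)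
    (X := fun x : Reward => (x : ℝ)) measurable_subtype_coe.aemeasurable
    (Eventually.of_forall fun x => x.2)
  change HasSubgaussianMGF (fun x : Reward => (x : ℝ) - mean ν) _ _ at H
  have hm := H.mgf_le (4 * d)
  have hi := H.integrable_exp_mul (4 * d)
  have e : ∀ x : Reward, Real.exp (4 * d * (x - mean ν) - 2 * d ^ 2) =
      Real.exp (4 * d * (x - mean ν)) * Real.exp (-(2 * d ^ 2)) := fun x => by
    rw [← Real.exp_add]; ring_nf
  simp only [e]
  rw [← ofReal_integral_eq_lintegral_ofReal (hi.mul_const _)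
    (Eventually.of_forall fun x => by positivity), integral_mul_const]
  rw [ENNReal.ofReal_le_one]
  calc _ ≤ _ := mul_le_mul_of_nonneg_right hm (Real.exp_nonneg _)
    _ = 1 := by
      rw [← Real.exp_add, Real.exp_eq_one_iff]
      push_cast
      norm_num
      ring

/-- Hoeffding's inequality, after at least `m` pulls: for `d > 0` the event is that the empirical
mean of arm `j` exceeds its mean by `d`, for `d < 0` that it is below its mean by `-d`. -/
theorem measure_deviation_le (π : Policy K) (θ : Env K) (j : Fin K) (d : ℝ) (t : ℕ) (m : ℝ) :
    histLaw π θ t {h | m ≤ pulls h j ∧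
      d ^ 2 * pulls h j ≤ d * (rewardSum h j - mean (θ j) * pulls h j)} ≤
      ENNReal.ofReal (Real.exp (-(2 * d ^ 2 * m))) := by
  refine measure_le_of_one_le_mul_prod π θ j
    (w := fun x => ENNReal.ofReal (Real.exp (4 * d * (x - mean (θ j)) - 2 * d ^ 2)))
    (by fun_prop) (lintegral_exp_le_one _ d) _ _ ?_
  rintro h ⟨hm, hd⟩
  have : ∏ s, (if (h s).1 = j then
      ENNReal.ofReal (Real.exp (4 * d * ((h s).2 - mean (θ j)) - 2 * d ^ 2)) else 1) =
      ENNReal.ofReal (Real.exp (4 * d * (rewardSum h j - mean (θ j) * pulls h j)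
        - 2 * d ^ 2 * pulls h j)) := by
    rw [rewardSum, pulls_eq_sum, Nat.cast_sum, Finset.mul_sum, ← Finset.sum_sub_distrib,
      Finset.mul_sum, Finset.mul_sum, ← Finset.sum_sub_distrib, Real.exp_sum,
      ENNReal.ofReal_prod_of_nonneg fun s _ => Real.exp_nonneg _]
    refine Finset.prod_congr rfl fun s _ => ?_
    by_cases hs : (h s).1 = j <;> simp [hs]
  rw [this, ← ENNReal.ofReal_mul (Real.exp_nonneg _), ← Real.exp_add, ENNReal.one_le_ofReal,
    Real.one_le_exp_iff]
  -- On the event the exponent is at least 4d²T - 2d²T = 2d²T ≥ 2d²m, where T is the number of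
  -- pulls.
  nlinarith [mul_le_mul_of_nonneg_left hm (sq_nonneg d)]

/-! ### Two-point distributions -/

theorem coe_twoPoint (p a b : Reward) : (twoPoint p a b : Measure Reward) =
    ENNReal.ofReal (p : ℝ) • Measure.dirac a + ENNReal.ofReal (1 - (p : ℝ)) • Measure.dirac b :=
  rfl

theorem coe_twoPoint_one (a b : Reward) : (twoPoint 1 a b : Measure Reward) =
    Measure.dirac a := by
  simp [coe_twoPoint]

theorem mean_twoPoint (p a b : Reward) : mean (twoPoint p a b) = p * a + (1 - p) * b := by
  have hp0 : (0 : ℝ) ≤ p := p.2.1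
  have hp1 : (0 : ℝ) ≤ 1 - (p : ℝ) := sub_nonneg.2 p.2.2
  rw [mean, coe_twoPoint, integral_add_measure, integral_smul_measure, integral_smul_measure,
    integral_dirac, integral_dirac, ENNReal.toReal_ofReal hp0, ENNReal.toReal_ofReal hp1]
  · rfl
  · exact (integrable_dirac (by simp)).smul_measure ENNReal.ofReal_ne_top
  · exact (integrable_dirac (by simp)).smul_measure ENNReal.ofReal_ne_top

theorem update_mem_envSet {Θ : Fin K → Set (ProbabilityMeasure Reward)} {θ : Env K}
    (hθ : θ ∈ envSet Θ) {k : Fin K} {ν : ProbabilityMeasure Reward} (hν : ν ∈ Θ k) :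
    Function.update θ k ν ∈ envSet Θ := by
  intro j
  by_cases hj : j = k
  · subst hj; simpa using hν
  · simpa [hj] using hθ j

theorem bestMean_lt_of_forall [Nonempty (Fin K)] {θ : Env K} {c : ℝ}
    (H : ∀ k, mean (θ k) < c) : bestMean θ < c := by
  obtain ⟨k, hk⟩ := exists_mean_eq_bestMean θ
  exact hk ▸ H k

/-! ### Lower bounds on the regret -/

theorem integrable_pow_pulls_mul (π : Policy K) (θ : Env K) (k : Fin K) {w : ℝ} (hw0 : 0 ≤ w)
    (hw1 : w ≤ 1) (t : ℕ) :
    Integrable (fun h => w ^ pulls h k * ((t : ℝ) - pulls h k)) (histLaw π θ t) := by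
  refine integrable_of_bound (((measurable_from_top (f := fun n : ℕ => w ^ n)).comp
    (measurable_pulls k)).mul (measurable_const.sub (measurable_pulls_real k))) t fun h => ?_
  have h0 : (0 : ℝ) ≤ t - pulls h k := sub_nonneg.2 (by exact_mod_cast pulls_le h k)
  rw [abs_of_nonneg (mul_nonneg (pow_nonneg hw0 _) h0)]
  calc _ ≤ 1 * ((t : ℝ) - pulls h k) := mul_le_mul_of_nonneg_right (pow_le_one₀ hw0 hw1) h0
    _ ≤ t := by rw [one_mul]; exact sub_le_self _ (Nat.cast_nonneg _)

/-- The change of measure is tested on the number of pulls of the other arms, which is what costs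
regret once arm `k` has become the best. -/
theorem integral_pow_pulls_mul_le (π : Policy K) (θ : Env K) (k : Fin K)
    (ν : ProbabilityMeasure Reward) {w : ℝ} (hw0 : 0 ≤ w) (hw1 : w ≤ 1)
    (hw : ENNReal.ofReal w • (θ k : Measure Reward) ≤ (ν : Measure Reward)) (t : ℕ) :
    ∫ h, w ^ pulls h k * (t - pulls h k) ∂(histLaw π θ t) ≤
      t - expPulls π (Function.update θ k ν) t k := by
  have hT : ∀ h : Hist K t, (0 : ℝ) ≤ t - pulls h k := fun h =>
    sub_nonneg.2 (by exact_mod_cast pulls_le h k)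
  have mT : Measurable fun h : Hist K t => (t - pulls h k : ℝ) :=
    measurable_const.sub (measurable_pulls_real k)
  have H := lintegral_pow_pulls_mul_le π θ k ν (ENNReal.ofReal w) hw t mT.ennreal_ofReal
  have hi : Integrable (fun h : Hist K t => (t - pulls h k : ℝ))
      (histLaw π (Function.update θ k ν) t) :=
    (integrable_const _).sub (integrable_pulls _ _ _ _)
  rw [← ofReal_integral_eq_lintegral_ofReal hi (Eventually.of_forall hT),
    integral_sub (integrable_const _) (integrable_pulls _ _ _ _)] at H
  have e : ∀ h : Hist K t, ENNReal.ofReal w ^ pulls h k * ENNReal.ofReal (t - pulls h k) =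
      ENNReal.ofReal (w ^ pulls h k * (t - pulls h k)) := fun h => by
    rw [ENNReal.ofReal_mul (pow_nonneg hw0 _), ENNReal.ofReal_pow hw0]
  simp only [e] at H
  rw [← ofReal_integral_eq_lintegral_ofReal (integrable_pow_pulls_mul π θ k hw0 hw1 t)
    (Eventually.of_forall fun h => mul_nonneg (pow_nonneg hw0 _) (hT h))] at H
  rw [ENNReal.ofReal_le_ofReal_iff'] at H
  have hE : expPulls π (Function.update θ k ν) t k ≤ t := by
    rw [← sum_expPulls π (Function.update θ k ν) t]
    exact Finset.single_le_sum (f := expPulls π (Function.update θ k ν) t)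
      (fun j _ => expPulls_nonneg _ _ _ _) (Finset.mem_univ k)
  rcases H with H | H
  · simpa [expPulls] using H
  · exact H.trans (sub_nonneg.2 hE)

/-- With T the number of pulls and τ its mean, E[exp(-lT)] ≥ exp(-lτ) by Jensen, proved through the
tangent line at τ, and T exp(-lT) ≤ 1/l bounds the remaining term. -/
theorem mul_exp_neg_expPulls_sub_le (π : Policy K) (θ : Env K) (k : Fin K)
    (ν : ProbabilityMeasure Reward) {l : ℝ} (hl : 0 < l)
    (hw : ENNReal.ofReal (Real.exp (-l)) • (θ k : Measure Reward) ≤ (ν : Measure Reward))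
    (t : ℕ) :
    t * Real.exp (-(l * expPulls π θ t k)) - l⁻¹ ≤
      t - expPulls π (Function.update θ k ν) t k := by
  refine le_trans ?_ (integral_pow_pulls_mul_le π θ k ν (Real.exp_nonneg _)
    (Real.exp_le_one_iff.2 (neg_nonpos.2 hl.le)) hw t)
  set τ := expPulls π θ t k with hτ
  have hint : ∫ h, (t * (Real.exp (-(l * τ)) * (1 + l * τ - l * (pulls h k : ℝ))) - l⁻¹)
      ∂(histLaw π θ t) = t * Real.exp (-(l * τ)) - l⁻¹ := by
    have i1 : Integrable (fun h : Hist K t => l * (pulls h k : ℝ)) (histLaw π θ t) :=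
      (integrable_pulls π θ t k).const_mul l
    have i2 : Integrable (fun h : Hist K t => 1 + l * τ - l * (pulls h k : ℝ))
      (histLaw π θ t) := (integrable_const _).sub i1
    rw [integral_sub ((i2.const_mul _).const_mul _) (integrable_const _), integral_const_mul,
      integral_const_mul, integral_sub (integrable_const _) i1, integral_const_mul]
    change _ * (_ * (_ - l * τ)) - _ = _
    simp
  rw [← hint]
  refine integral_mono ?_ ?_ fun h => ?_
  · exact ((((integrable_const _).sub ((integrable_pulls π θ t k).const_mul l)).const_mul
      _).const_mul _).sub (integrable_const _)
  · exact integrable_pow_pulls_mul π θ k (Real.exp_nonneg _)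
      (Real.exp_le_one_iff.2 (neg_nonpos.2 hl.le)) t
  · simp only
    rw [← Real.exp_nat_mul]
    set T : ℝ := (pulls h k : ℝ)
    have h1 : Real.exp (-(l * τ)) * (1 + l * τ - l * T) ≤ Real.exp (T * -l) := by
      have : T * -l = -(l * τ) + (l * τ - l * T) := by ring
      rw [this, Real.exp_add]
      refine mul_le_mul_of_nonneg_left ?_ (Real.exp_nonneg _)
      linarith [Real.add_one_le_exp (l * τ - l * T)]
    have h2 : Real.exp (T * -l) * T ≤ l⁻¹ := by
      have h3 : T * l ≤ Real.exp (T * l) := by linarith [Real.add_one_le_exp (T * l)]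
      rw [mul_neg, Real.exp_neg, inv_mul_le_iff₀ (Real.exp_pos _), ← div_eq_mul_inv,
        le_div_iff₀ hl]
      exact h3
    nlinarith [mul_le_mul_of_nonneg_left h1 (Nat.cast_nonneg (α := ℝ) t)]

/-- If the regret is `o(n ^ b)` once arm `k` is modified into a best arm, then arm `k` is pulled
at least `(1 - b) * log n / l` times in the original environment. -/
theorem eventually_log_le_expPulls (A : HorizonPolicy K) (θ : Env K) (k : Fin K)
    (ν : ProbabilityMeasure Reward) {l d b : ℝ} (hl : 0 < l) (hd : 0 < d) (hb : 0 < b)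
    (hw : ENNReal.ofReal (Real.exp (-l)) • (θ k : Measure Reward) ≤ (ν : Measure Reward))
    (hν : ∀ j, j ≠ k → mean (θ j) + d ≤ mean ν)
    (hA : (fun n : ℕ => expRegret A (Function.update θ k ν) n) =o[atTop]
      fun n : ℕ => (n : ℝ) ^ b) :
    ∀ᶠ n : ℕ in atTop, (1 - b) * Real.log n ≤ l * expPulls (A n) θ n k := by
  -- Half of n^b bounds the pulls of the other arms in the modified environment, the other half
  -- absorbs the error `l⁻¹`; taking logarithms in n exp(-lτ) ≤ n^b then concludes.
  have h1 := hA.bound (half_pos hd)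
  have h2 := ((tendsto_rpow_atTop hb).comp tendsto_natCast_atTop_atTop).eventually_ge_atTop
    (2 * l⁻¹)
  filter_upwards [h1, h2, eventually_gt_atTop 0] with n h1 h2 hn
  have hn' : (0 : ℝ) < n := by exact_mod_cast hn
  have h3 := mul_exp_neg_expPulls_sub_le (A n) θ k ν hl hw n
  have h4 := mul_sub_expPulls_le A (Function.update θ k ν) n k (d := d) fun j hj => by
    simpa [hj] using hν j hj
  rw [Real.norm_of_nonneg (expRegret_nonneg _ _ _),
    Real.norm_of_nonneg (Real.rpow_nonneg hn'.le _)] at h1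
  simp only [Function.comp_apply] at h2
  have h5 : (n : ℝ) - expPulls (A n) (Function.update θ k ν) n k ≤ (n : ℝ) ^ b / 2 := by
    have := h4.trans h1
    rw [div_mul_eq_mul_div, mul_div_assoc] at this
    exact le_of_mul_le_mul_left this hd
  have h6 : n * Real.exp (-(l * expPulls (A n) θ n k)) ≤ (n : ℝ) ^ b := by linarith
  have h7 := Real.log_le_log (by positivity) h6
  rw [Real.log_mul hn'.ne' (Real.exp_ne_zero _), Real.log_exp, Real.log_rpow hn'] at h7
  linarith

/-- A consistent policy cannot ignore a suboptimal arm, if the best arms do not have mean `1`. -/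
theorem eventually_expRegret_pos (A : HorizonPolicy K) (θ : Env K) {k : Fin K}
    (hk : mean (θ k) < bestMean θ) (h1 : bestMean θ < 1)
    (hA : (fun n : ℕ => expRegret A (Function.update θ k (twoPoint 1 1 1)) n) =o[atTop]
      fun n : ℕ => (n : ℝ) ^ (1 : ℝ)) :
    ∀ᶠ n : ℕ in atTop, 0 < expRegret A θ n := by
  have hd : 0 < 1 - bestMean θ := sub_pos.2 h1
  filter_upwards [hA.bound (half_pos hd), eventually_gt_atTop 0] with n hb hn
  have hn' : (0 : ℝ) < n := by exact_mod_cast hn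
  refine lt_of_le_of_ne (expRegret_nonneg _ _ _) fun h0 => ?_
  have hE : expPulls (A n) θ n k = 0 := by
    have := gap_mul_expPulls_le A θ n k
    rw [← h0] at this
    exact le_antisymm (nonpos_of_mul_nonpos_right this (sub_pos.2 hk)) (expPulls_nonneg _ _ _ _)
  have hae := (integral_eq_zero_iff_of_nonneg (fun _ => Nat.cast_nonneg _)
    (integrable_pulls (A n) θ n k)).1 hE
  -- With weight 0 and the convention 0^0 = 1, only the histories that never draw arm `k` count. If
  -- these have full measure here, they also do after the modification, where they cost linear
  -- regret.
  have h3 := integral_pow_pulls_mul_le (A n) θ k (twoPoint 1 1 1) le_rfl zero_le_one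
    (by simpa using Measure.zero_le _) n
  have h5 : ∫ h, (0 : ℝ) ^ pulls h k * (n - pulls h k) ∂(histLaw (A n) θ n) = n := by
    rw [integral_congr_ae (g := fun _ => (n : ℝ))]
    · simp
    · filter_upwards [hae] with h hh
      have : pulls h k = 0 := Nat.cast_eq_zero.1 hh
      simp [this]
  rw [h5] at h3
  have h4 := mul_sub_expPulls_le A (Function.update θ k (twoPoint 1 1 1)) n k
    (d := 1 - bestMean θ) fun j hj => by
      have := mean_le_bestMean θ j
      simp only [ne_eq, hj, not_false_eq_true, Function.update_of_ne, Function.update_self,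
        mean_twoPoint]
      norm_num
      linarith
  rw [Real.norm_of_nonneg (expRegret_nonneg _ _ _),
    Real.norm_of_nonneg (Real.rpow_nonneg hn'.le _), Real.rpow_one] at hb
  nlinarith [mul_le_mul_of_nonneg_left h3 hd.le, mul_pos hd hn']

/-! ### The environment with deterministic rewards -/

/-- Arm `i` always gives the reward `a`, the other arms always give the reward `0`. -/
def pointEnv (i : Fin K) (a : Reward) : Env K := fun j => twoPoint 1 (if j = i then a else 0) 0

/-- The rewards could have been observed in the environment `pointEnv i a`. -/
def Compat (i : Fin K) (a : Reward) {t : ℕ} (h : Hist K t) : Prop :=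
  ∀ s, (h s).2 = if (h s).1 = i then a else 0

theorem measurableSet_compat (i : Fin K) (a : Reward) (t : ℕ) :
    MeasurableSet {h : Hist K t | Compat i a h} := by
  simp only [Compat, Set.ofPred_forall]
  exact MeasurableSet.iInter fun s => measurableSet_eq_fun (measurable_reward s)
    (Measurable.ite (measurableSet_arm_eq s i) measurable_const measurable_const)

theorem compat_snoc {i : Fin K} {a : Reward} {t : ℕ} {h : Hist K t} (hh : Compat i a h)
    (k : Fin K) : Compat i a (Fin.snoc h (k, if k = i then a else 0) : Hist K (t + 1)) := by
  refine Fin.lastCases ?_ fun s => ?_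
  · simp
  · simpa using hh s

theorem Compat.rewardSum_eq {i : Fin K} {a : Reward} {t : ℕ} {h : Hist K t}
    (hh : Compat i a h) (k : Fin K) :
    rewardSum h k = (if k = i then (a : ℝ) else 0) * pulls h k := by
  rw [rewardSum, pulls_eq_sum, Nat.cast_sum, Finset.mul_sum]
  refine Finset.sum_congr rfl fun s _ => ?_
  by_cases hs : (h s).1 = k
  · subst hs
    rw [hh s]
    split_ifs <;> simp
  · simp [hs]

theorem mean_pointEnv (i : Fin K) (a : Reward) (j : Fin K) :
    mean (pointEnv i a j) = if j = i then (a : ℝ) else 0 := by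
  rw [pointEnv, mean_twoPoint]
  split_ifs <;> simp

theorem bestMean_pointEnv (i : Fin K) (a : Reward) : bestMean (pointEnv i a) = a := by
  have : Nonempty (Fin K) := ⟨i⟩
  refine le_antisymm (ciSup_le fun j => ?_) ?_
  · rw [mean_pointEnv]
    split_ifs
    · exact le_rfl
    · exact a.2.1
  · simpa [mean_pointEnv] using mean_le_bestMean (pointEnv i a) i

theorem expRegret_pointEnv (A : HorizonPolicy K) (i : Fin K) (a : Reward) (n : ℕ) :
    expRegret A (pointEnv i a) n =
      ∑ k ∈ Finset.univ.erase i, a * expPulls (A n) (pointEnv i a) n k := by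
  rw [expRegret_eq, ← Finset.add_sum_erase _ _ (Finset.mem_univ i), bestMean_pointEnv]
  simp only [mean_pointEnv, if_true, sub_self, zero_mul, zero_add]
  refine Finset.sum_congr rfl fun k hk => ?_
  simp [Finset.ne_of_mem_erase hk]

/-- A pull happens only while the count is at most c log(t+1), so it leaves the count at most one
above this level; between pulls the level only grows. -/
theorem ae_compat_and_pulls_le (π : Policy K) (i : Fin K) (a : Reward) {c : ℝ} (hc : 0 ≤ c)
    (H : ∀ (t : ℕ) (h : Hist K t), Compat i a h → ∀ᵐ k ∂(π.choose t h),
      k ≠ i → (pulls h k : ℝ) ≤ c * Real.log (t + 1)) (t : ℕ) :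
    ∀ᵐ h ∂(histLaw π (pointEnv i a) t),
      Compat i a h ∧ ∀ k, k ≠ i → (pulls h k : ℝ) ≤ c * Real.log t + 1 := by
  induction t with
  | zero => exact Eventually.of_forall fun h => ⟨fun s => s.elim0, fun k _ => by simp [pulls_zero]⟩
  | succ t ih =>
    refine ae_histLaw_succ _ _ _ ?_ ?_
    · have : MeasurableSet {h : Hist K (t + 1) |
          ∀ k, k ≠ i → (pulls h k : ℝ) ≤ c * Real.log (t + 1 : ℕ) + 1} := by
        simp only [Set.ofPred_forall]
        exact MeasurableSet.iInter fun k => MeasurableSet.iInter fun _ =>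
          measurableSet_le (measurable_pulls_real k) measurable_const
      exact (measurableSet_compat i a _).inter this
    · filter_upwards [ih] with h ⟨hh, hp⟩
      filter_upwards [H t h hh] with k hk
      rw [pointEnv, coe_twoPoint_one, ae_dirac_eq]
      refine ⟨compat_snoc hh k, fun j hj => ?_⟩
      rw [pulls_snoc]
      push_cast
      by_cases hkj : k = j
      · subst hkj
        simpa using hk hj
      · have h0 : Real.log t ≤ Real.log (t + 1) := by
          -- At t = 0 both sides vanish, since `Real.log 0 = 0`.
          rcases Nat.eq_zero_or_pos t with rfl | ht
          · simp
          · exact Real.log_le_log (by exact_mod_cast ht) (by linarith)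
        have := mul_le_mul_of_nonneg_left h0 hc
        have := hp j hj
        simp only [hkj, if_false]
        linarith

theorem expRegret_pointEnv_le (A : HorizonPolicy K) (i : Fin K) (a : Reward) {c : ℝ}
    (hc : 0 ≤ c)
    (H : ∀ (n t : ℕ) (h : Hist K t), Compat i a h → ∀ᵐ k ∂((A n).choose t h),
      k ≠ i → (pulls h k : ℝ) ≤ c * Real.log (t + 1)) (n : ℕ) :
    expRegret A (pointEnv i a) n ≤ (K - 1 : ℝ) * (a * (c * Real.log n + 1)) := by
  have hK : ((Finset.univ.erase i).card : ℝ) = K - 1 := by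
    rw [Finset.card_erase_of_mem (Finset.mem_univ i), Finset.card_univ, Fintype.card_fin,
      Nat.cast_pred (Fin.pos i)]
  rw [expRegret_pointEnv, ← hK, ← nsmul_eq_mul]
  refine Finset.sum_le_card_nsmul _ _ _ fun k hk => mul_le_mul_of_nonneg_left ?_ a.2.1
  refine expPulls_le_of_ae ?_
  filter_upwards [ae_compat_and_pulls_le (A n) i a hc (H n) n] with h hh
  exact hh.2 k (Finset.ne_of_mem_erase hk)

/-- The asymptotic lower bound on the regret in the environment `pointEnv i a`. -/
theorem exists_one_lt_mul_le_expRegret_pointEnv {Θ : Fin K → Set (ProbabilityMeasure Reward)}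
    (hΘ : ∀ (k : Fin K) (p a b : Reward), twoPoint p a b ∈ Θ k)
    (A : HorizonPolicy K) {α : ℝ} (hα : 0 ≤ α)
    (hA : ∀ b : ℝ, α < b → ∀ θ ∈ envSet Θ, bestMean θ < 1 →
      (fun n : ℕ => expRegret A θ n) =o[atTop] fun n : ℕ => (n : ℝ) ^ b)
    (i : Fin K) {a : Reward} (ha0 : 0 < (a : ℝ)) (ha1 : (a : ℝ) < 1) {c : ℝ} (hc : 0 ≤ c)
    (hcα : c * -Real.log (1 - a) < 1 - α) :
    ∃ r : ℝ, 1 < r ∧ ∀ᶠ n : ℕ in atTop,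
      r * ((K - 1 : ℝ) * (a * (c * Real.log n + 1))) ≤ expRegret A (pointEnv i a) n := by
  have : Nonempty (Fin K) := ⟨i⟩
  have hL : 0 < -Real.log (1 - a) := neg_pos.2 (Real.log_neg (by linarith) (by linarith))
  -- The strict inequality `hcα` leaves room for three choices: l above -log(1-a), b above α, and a
  -- ratio r above 1.
  obtain ⟨l, hl, hcl⟩ : ∃ l, -Real.log (1 - a) < l ∧ c * l < 1 - α := by
    set L := -Real.log (1 - (a : ℝ))
    refine ⟨L + (1 - α - c * L) / (c + 1), lt_add_of_pos_right _
      (div_pos (by linarith) (by linarith)), ?_⟩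
    have : c * ((1 - α - c * L) / (c + 1)) < 1 - α - c * L := by
      rw [← mul_div_assoc, div_lt_iff₀ (by linarith)]
      nlinarith
    linarith
  obtain ⟨b, hαb, hcb⟩ : ∃ b, α < b ∧ b < 1 - c * l := exists_between (by linarith)
  have hl0 : 0 < l := hL.trans hl
  have hp1 : Real.exp (-l) < 1 - a := by
    rw [← Real.lt_log_iff_exp_lt (by linarith)]; linarith
  have hcl0 : 0 ≤ c * l := mul_nonneg hc hl0.le
  obtain ⟨r, hr1, hr⟩ : ∃ r, 1 < r ∧ r * (c * l) < 1 - b := by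
    refine ⟨1 + (1 - b - c * l) / (c * l + 1), lt_add_of_pos_right _
      (div_pos (by linarith) (by linarith)), ?_⟩
    have : (1 - b - c * l) / (c * l + 1) * (c * l) < 1 - b - c * l := by
      rw [div_mul_eq_mul_div, div_lt_iff₀ (by linarith)]
      nlinarith
    linarith
  refine ⟨r, hr1, ?_⟩
  -- As p < 1 - a, the modified arm has mean 1 - p > a; as p > 0, this mean stays below 1, so that
  -- `hA` applies.
  let p : Reward := ⟨Real.exp (-l), Real.exp_nonneg _, by linarith⟩
  have key : ∀ k : Fin K, k ≠ i → ∀ᶠ n : ℕ in atTop,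
      (1 - b) * Real.log n ≤ l * expPulls (A n) (pointEnv i a) n k := fun k hk => by
    have hm : mean (twoPoint p 0 1) = 1 - Real.exp (-l) := by
      rw [mean_twoPoint]
      simp [p]
    refine eventually_log_le_expPulls A (pointEnv i a) k (twoPoint p 0 1) hl0
      (d := 1 - a - Real.exp (-l)) (by linarith) (by linarith) ?_ ?_ (hA b hαb _ ?_ ?_)
    · rw [pointEnv, coe_twoPoint_one, coe_twoPoint, if_neg hk]
      exact Measure.le_add_right le_rfl
    · intro j _
      rw [mean_pointEnv, hm]
      split_ifs
      · linarith
      · linarith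
    · exact update_mem_envSet (fun j => hΘ j _ _ _) (hΘ k _ _ _)
    · refine bestMean_lt_of_forall fun j => ?_
      by_cases hj : j = k
      · subst hj
        rw [Function.update_self, hm]
        linarith [Real.exp_pos (-l)]
      · rw [Function.update_of_ne hj, mean_pointEnv]
        split_ifs
        · exact ha1
        · exact one_pos
  -- Beyond this value, the slack in the coefficient of log n absorbs the additive 1.
  have hlog := (Real.tendsto_log_atTop.comp tendsto_natCast_atTop_atTop).eventually_ge_atTop
    (r * l / (1 - b - r * (c * l)))
  filter_upwards [eventually_all.2 fun k => eventually_imp_distrib_left.2 (key k), hlog]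
    with n hn hlog
  have hKc : ((Finset.univ.erase i).card : ℝ) = K - 1 := by
    rw [Finset.card_erase_of_mem (Finset.mem_univ i), Finset.card_univ, Fintype.card_fin,
      Nat.cast_pred (Fin.pos i)]
  rw [expRegret_pointEnv, mul_left_comm, ← hKc, ← nsmul_eq_mul]
  refine Finset.card_nsmul_le_sum _ _ _ fun k hk => ?_
  rw [mul_left_comm]
  refine mul_le_mul_of_nonneg_left ?_ a.2.1
  have h1 := hn k (Finset.ne_of_mem_erase hk)
  simp only [Function.comp_apply] at hlog
  rw [div_le_iff₀ (by linarith)] at hlog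
  refine le_of_mul_le_mul_left ?_ hl0
  linarith

/-! ### UCB policies -/

/-- Arm `i` has index at least a, while another arm has empirical mean 0 and only its bonus; to be
chosen, it needs a bonus of at least a. -/
theorem IsUCB.ae_pulls_le_of_compat {ρ : ℝ} (hρ : 0 < ρ) {π : Policy K} (hπ : IsUCB ρ π)
    {i : Fin K} {a : Reward} (ha : 0 < (a : ℝ)) {t : ℕ} (h : Hist K t) (hh : Compat i a h) :
    ∀ᵐ k ∂(π.choose t h), k ≠ i → (pulls h k : ℝ) ≤ ρ / a ^ 2 * Real.log (t + 1) := by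
  have hlog : 0 ≤ Real.log ((t : ℝ) + 1) := Real.log_nonneg (by simp)
  filter_upwards [hπ t h] with k ⟨h1, h2⟩ hki
  by_cases h0 : ∃ j, pulls h j = 0
  · rw [h1 h0, Nat.cast_zero]
    positivity
  · push Not at h0
    have hk : (0 : ℝ) < pulls h k := by exact_mod_cast Nat.pos_of_ne_zero (h0 k)
    have hi : (pulls h i : ℝ) ≠ 0 := by exact_mod_cast h0 i
    have h3 := h2 h0 i
    rw [ucbIndex, ucbIndex, empMean_eq, empMean_eq, hh.rewardSum_eq, hh.rewardSum_eq, if_pos rfl,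
      if_neg hki, zero_mul, zero_div, zero_add, mul_div_cancel_right₀ _ hi] at h3
    have h4 := Real.le_sqrt' ha |>.1 (le_trans (le_add_of_nonneg_right (Real.sqrt_nonneg _)) h3)
    rw [le_div_iff₀ hk] at h4
    rw [div_mul_eq_mul_div, le_div_iff₀ (by positivity)]
    linarith

/-- Invariant: while some arm is undrawn, no arm has been drawn twice. An undrawn arm after t rounds
then forces t < K. -/
theorem IsUCB.ae_pulls_ne_zero {ρ : ℝ} {π : Policy K} (hπ : IsUCB ρ π) (θ : Env K) {t : ℕ}
    (ht : K ≤ t) : ∀ᵐ h ∂(histLaw π θ t), ∀ k, pulls h k ≠ 0 := by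
  have H : ∀ t, ∀ᵐ h ∂(histLaw π θ t), (∃ j, pulls h j = 0) → ∀ k, pulls h k ≤ 1 := by
    intro t
    induction t with
    | zero => exact Eventually.of_forall fun h _ k => by simp [pulls_zero]
    | succ t ih =>
      refine ae_histLaw_succ _ _ _ ?_ ?_
      · have : ∀ j k : Fin K, MeasurableSet {h : Hist K (t + 1) | pulls h j = 0 → pulls h k ≤ 1} :=
          fun j k => MeasurableSet.imp (measurable_pulls j (measurableSet_singleton 0))
            (measurable_pulls k (Set.to_countable {n | n ≤ 1}).measurableSet)
        simp only [exists_imp, Set.ofPred_forall]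
        convert MeasurableSet.iInter fun j => MeasurableSet.iInter fun k => this j k using 1
        ext h
        simp only [Set.mem_ofPred_eq, Set.mem_iInter]
        tauto
      · filter_upwards [ih] with h hh
        filter_upwards [hπ t h] with k ⟨hk, _⟩
        refine Eventually.of_forall fun x ⟨j, hj⟩ l => ?_
        rw [pulls_snoc] at hj ⊢
        have hj0 : pulls h j = 0 := by omega
        by_cases hkl : k = l
        · subst hkl
          simp [hk ⟨j, hj0⟩]
        · simpa [hkl] using hh ⟨j, hj0⟩ l
  filter_upwards [H t] with h hh k hk
  have h1 := hh ⟨k, hk⟩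
  have h2 : ∑ j, pulls h j < ∑ _j : Fin K, 1 :=
    Finset.sum_lt_sum (fun j _ => h1 j) ⟨k, Finset.mem_univ k, by omega⟩
  rw [sum_pulls] at h2
  simp at h2
  omega

theorem expRegret_pos_of_isUCB {ρ : ℝ} {U : HorizonPolicy K} (hU : ∀ n, IsUCB ρ (U n))
    (θ : Env K) {k : Fin K} (hk : mean (θ k) < bestMean θ) {n : ℕ} (hn : K ≤ n) :
    0 < expRegret U θ n := by
  refine lt_of_lt_of_le (mul_pos (sub_pos.2 hk) (lt_of_lt_of_le one_pos ?_))
    (gap_mul_expPulls_le U θ n k)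
  refine le_expPulls_of_ae ?_
  filter_upwards [(hU n).ae_pulls_ne_zero θ hn] with h hh
  exact_mod_cast Nat.one_le_iff_ne_zero.2 (hh k)

/-! ### Comparison of regrets -/

theorem one_lt_limsup_of_frequently {u : ℕ → ℝ} {r : ℝ} (hr : 1 < r)
    (h : ∃ᶠ n in atTop, r ≤ u n) :
    1 < limsup (fun n => ((u n : ℝ) : EReal)) atTop :=
  lt_of_lt_of_le (by exact_mod_cast hr)
    (le_limsup_of_frequently_le (h.mono fun n hn => EReal.coe_le_coe_iff.2 hn))

/-- If f < 2g eventually, then f would inherit the o(n^b) of g. -/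
theorem frequently_two_le_div {f g : ℕ → ℝ} {b : ℝ} (hf : ∀ n, 0 ≤ f n)
    (hg : ∀ᶠ n in atTop, 0 < g n) (hgb : g =o[atTop] fun n : ℕ => (n : ℝ) ^ b)
    (hfb : ¬ f =o[atTop] fun n : ℕ => (n : ℝ) ^ b) : ∃ᶠ n in atTop, 2 ≤ f n / g n := by
  intro h
  refine hfb (Asymptotics.IsBigO.trans_isLittleO (Asymptotics.IsBigO.of_bound 2 ?_) hgb)
  filter_upwards [h, hg] with n hn hgn
  rw [not_le, div_lt_iff₀ hgn] at hn
  rw [Real.norm_of_nonneg (hf n), Real.norm_of_nonneg hgn.le]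
  exact hn.le

/-- If all arms were optimal, the regret would vanish identically. -/
theorem exists_mean_lt_bestMean {A : HorizonPolicy K} {θ : Env K} {b : ℝ}
    (h : ¬ (fun n : ℕ => expRegret A θ n) =o[atTop] fun n : ℕ => (n : ℝ) ^ b) :
    ∃ k, mean (θ k) < bestMean θ := by
  by_contra! H
  refine h ?_
  have : (fun n : ℕ => expRegret A θ n) = fun _ => 0 := by
    funext n
    rw [expRegret_eq]
    refine Finset.sum_eq_zero fun k _ => ?_
    rw [le_antisymm (H k) (mean_le_bestMean θ k), sub_self, zero_mul]
  rw [this]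
  exact Asymptotics.isLittleO_zero _ _

/-- `A` is beaten in the environment `pointEnv i a`, if it has a regret `o(n ^ b)`, `b > α`. -/
theorem one_lt_limsup_div_pointEnv {Θ : Fin K → Set (ProbabilityMeasure Reward)}
    (hΘ : ∀ (k : Fin K) (p a b : Reward), twoPoint p a b ∈ Θ k)
    (A : HorizonPolicy K) {α : ℝ} (hα : 0 ≤ α)
    (hA : ∀ b : ℝ, α < b → ∀ θ ∈ envSet Θ, bestMean θ < 1 →
      (fun n : ℕ => expRegret A θ n) =o[atTop] fun n : ℕ => (n : ℝ) ^ b)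
    (i : Fin K) {a : Reward} (ha0 : 0 < (a : ℝ)) (ha1 : (a : ℝ) < 1) {c : ℝ} (hc : 0 ≤ c)
    (hcα : c * -Real.log (1 - a) < 1 - α) {g : ℕ → ℝ} (hg : ∀ᶠ n in atTop, 0 < g n)
    (hgc : ∀ n : ℕ, g n ≤ (K - 1 : ℝ) * (a * (c * Real.log n + 1))) :
    1 < limsup (fun n => ((expRegret A (pointEnv i a) n / g n : ℝ) : EReal)) atTop := by
  obtain ⟨r, hr, H⟩ := exists_one_lt_mul_le_expRegret_pointEnv hΘ A hα hA i ha0 ha1 hc hcα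
  refine one_lt_limsup_of_frequently hr (Eventually.frequently ?_)
  filter_upwards [H, hg] with n hn hgn
  rw [le_div_iff₀ hgn]
  exact (mul_le_mul_of_nonneg_left (hgc n) (by linarith)).trans hn

/-! ### A policy that favours the environment with deterministic rewards -/

/-- The number of pulls of arm `k` below which the arm is explored. As long as the rewards could
come from `pointEnv i a`, the arms other than `i` are explored at a logarithmic rate. -/
def threshold (i : Fin K) (a : Reward) (α c : ℝ) {t : ℕ} (h : Hist K t) (k : Fin K) : ℝ :=
  open Classical in
  -- Arm `i` keeps the polynomial rate in all cases: its many pulls test whether it really always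
  -- pays `a`.
  if Compat i a h ∧ k ≠ i then c * Real.log (t + 1) else ((t : ℝ) + 1) ^ α

/-- No arm needs to be explored, and arm `k` is exploited: it is arm `i` if the rewards could come
from `pointEnv i a`, and an arm of maximal empirical mean otherwise. -/
def Exploits (i : Fin K) (a : Reward) (α c : ℝ) {t : ℕ} (h : Hist K t) (k : Fin K) : Prop :=
  (∀ j, threshold i a α c h j ≤ pulls h j) ∧
    ((Compat i a h ∧ k = i) ∨ (¬ Compat i a h ∧ ∀ j, empMean h j ≤ empMean h k))

/-- Arm `k` is explored: among the arms that need to be, it is one of those pulled the least. -/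
def Explores (i : Fin K) (a : Reward) (α c : ℝ) {t : ℕ} (h : Hist K t) (k : Fin K) : Prop :=
  (pulls h k : ℝ) < threshold i a α c h k ∧
    ∀ j, (pulls h j : ℝ) < threshold i a α c h j → pulls h k ≤ pulls h j

theorem exists_explores_or_exploits (i : Fin K) (a : Reward) (α c : ℝ) {t : ℕ} (h : Hist K t) :
    ∃ k, Explores i a α c h k ∨ Exploits i a α c h k := by
  classical
  by_cases H : ∃ j, (pulls h j : ℝ) < threshold i a α c h j
  · obtain ⟨k, hk, hmin⟩ := Finset.exists_min_image
      (Finset.univ.filter fun j => (pulls h j : ℝ) < threshold i a α c h j) (pulls h)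
      (by obtain ⟨j, hj⟩ := H; exact ⟨j, by simpa using hj⟩)
    exact ⟨k, Or.inl ⟨by simpa using hk, fun j hj => hmin j (by simpa using hj)⟩⟩
  · push Not at H
    by_cases hc : Compat i a h
    · exact ⟨i, Or.inr ⟨H, Or.inl ⟨hc, rfl⟩⟩⟩
    · obtain ⟨k, -, hk⟩ := Finset.exists_max_image Finset.univ (empMean h) ⟨i, Finset.mem_univ i⟩
      exact ⟨k, Or.inr ⟨H, Or.inr ⟨hc, fun j => hk j (Finset.mem_univ j)⟩⟩⟩

theorem measurable_threshold (i : Fin K) (a : Reward) (α c : ℝ) {t : ℕ} (k : Fin K) :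
    Measurable fun h : Hist K t => threshold i a α c h k :=
  Measurable.ite ((measurableSet_compat i a t).inter (MeasurableSet.const _)) measurable_const
    measurable_const

theorem measurable_explores_or_exploits (i : Fin K) (a : Reward) (α c : ℝ) {t : ℕ} (k : Fin K) :
    Measurable fun h : Hist K t => Explores i a α c h k ∨ Exploits i a α c h k := by
  have h1 : ∀ j, Measurable fun h : Hist K t => (pulls h j : ℝ) < threshold i a α c h j :=
    fun j => measurableSet_setOfPred.1
      (measurableSet_lt (measurable_pulls_real j) (measurable_threshold i a α c j))
  have h2 : ∀ j, Measurable fun h : Hist K t => threshold i a α c h j ≤ (pulls h j : ℝ) :=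
    fun j => measurableSet_setOfPred.1
      (measurableSet_le (measurable_threshold i a α c j) (measurable_pulls_real j))
  have h3 : ∀ j, Measurable fun h : Hist K t => pulls h k ≤ pulls h j :=
    fun j => measurableSet_setOfPred.1
      (measurableSet_le (measurable_pulls k) (measurable_pulls j))
  have h4 : ∀ j, Measurable fun h : Hist K t => empMean h j ≤ empMean h k :=
    fun j => measurableSet_setOfPred.1
      (measurableSet_le (measurable_empMean j) (measurable_empMean k))
  have h5 : Measurable fun h : Hist K t => Compat i a h :=
    measurableSet_setOfPred.1 (measurableSet_compat i a t)
  exact ((h1 k).and (Measurable.forall fun j => (h1 j).imp (h3 j))).or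
    ((Measurable.forall h2).and ((h5.and measurable_const).or
      (h5.not.and (Measurable.forall h4))))

/-- The policy that explores the arms pulled less than `threshold i a α c`, and otherwise
exploits. -/
def explorePolicy (i : Fin K) (a : Reward) (α c : ℝ) : Policy K where
  choose _ := Kernel.deterministic
    (fun h => @Classical.epsilon (Fin K) ⟨i⟩ fun k => Explores i a α c h k ∨ Exploits i a α c h k)
    -- The arm depends on the history only through the set of admissible arms, which takes finitely
    -- many values.
    ((measurable_of_countable (fun Q : Fin K → Prop => @Classical.epsilon (Fin K) ⟨i⟩ Q)).comp
      (measurable_pi_iff.2 fun k => measurable_explores_or_exploits i a α c k))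
  markov _ := inferInstance

theorem ae_explorePolicy (i : Fin K) (a : Reward) (α c : ℝ) {t : ℕ} (h : Hist K t) :
    ∀ᵐ k ∂((explorePolicy i a α c).choose t h), Explores i a α c h k ∨ Exploits i a α c h k := by
  rw [explorePolicy, Kernel.deterministic_apply, ae_dirac_eq]
  exact Classical.epsilon_spec (exists_explores_or_exploits i a α c h)

theorem ae_explorePolicy_of_compat (i : Fin K) (a : Reward) (α c : ℝ) {t : ℕ} (h : Hist K t)
    (hh : Compat i a h) : ∀ᵐ k ∂((explorePolicy i a α c).choose t h),
      k ≠ i → (pulls h k : ℝ) ≤ c * Real.log (t + 1) := by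
  filter_upwards [ae_explorePolicy i a α c h] with k hk hki
  rcases hk with hk | ⟨_, ⟨_, hk⟩ | ⟨hk, _⟩⟩
  · have := hk.1
    rw [threshold, if_pos ⟨hh, hki⟩] at this
    exact this.le
  · exact absurd hk hki
  · exact absurd hh hk

/-! ### Every arm is pulled infinitely often -/

theorem eventually_le_threshold (i : Fin K) (a : Reward) {α c : ℝ} (hα : 0 < α) (hc : 0 < c)
    (m : ℝ) : ∀ᶠ t : ℕ in atTop, ∀ (h : Hist K t) k, m ≤ threshold i a α c h k := by
  have h0 : Tendsto (fun t : ℕ => (t : ℝ) + 1) atTop atTop :=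
    tendsto_atTop_add_const_right _ _ tendsto_natCast_atTop_atTop
  filter_upwards [((Real.tendsto_log_atTop.comp h0).const_mul_atTop hc).eventually_ge_atTop m,
    ((tendsto_rpow_atTop hα).comp h0).eventually_ge_atTop m] with t h1 h2 h k
  rw [threshold]
  split_ifs
  exacts [h1, h2]

/-- Induction on `m`. Once every arm has m pulls and all thresholds are at least m + 1, an arm with
exactly m pulls must be explored, and exploration picks a least pulled one. So each round removes
one of the late arms, and K rounds suffice. -/
theorem eventually_ae_le_pulls (i : Fin K) (a : Reward) {α c : ℝ} (hα : 0 < α) (hc : 0 < c)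
    (θ : Env K) (m : ℕ) : ∀ᶠ t : ℕ in atTop,
      ∀ᵐ h ∂(histLaw (explorePolicy i a α c) θ t), ∀ k, m ≤ pulls h k := by
  induction m with
  | zero => simp
  | succ m ih =>
    obtain ⟨N, hN⟩ := eventually_atTop.1 (ih.and (eventually_le_threshold i a hα hc (m + 1)))
    have H : ∀ s : ℕ, ∀ᵐ h ∂(histLaw (explorePolicy i a α c) θ (N + s)),
        (Finset.univ.filter fun k => pulls h k ≤ m).card ≤ K - s := by
      intro s
      induction s with
      | zero => exact Eventually.of_forall fun h => (Finset.card_filter_le _ _).trans (by simp)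
      | succ s ihs =>
        refine ae_histLaw_succ _ _ (N + s) ?_ ?_
        · simp only [Finset.card_filter]
          refine measurableSet_le (Finset.measurable_sum _ fun k _ => Measurable.ite ?_
            measurable_const measurable_const) measurable_const
          exact measurableSet_le (measurable_pulls k) measurable_const
        · filter_upwards [ihs, (hN (N + s) (by omega)).1] with h hs hm
          filter_upwards [ae_explorePolicy i a α c h] with k hk
          refine Eventually.of_forall fun x => ?_
          rcases Finset.eq_empty_or_nonempty (Finset.univ.filter fun k => pulls h k ≤ m) with
            he | ⟨j, hj⟩
          · have : (Finset.univ.filter fun l =>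
                pulls (Fin.snoc h (k, x) : Hist K (N + s + 1)) l ≤ m) = ∅ := by
              rw [Finset.filter_eq_empty_iff] at he ⊢
              intro l hl
              have := he hl
              rw [pulls_snoc]
              omega
            rw [this]
            simp
          · have hj : pulls h j ≤ m := by simpa using hj
            have hjt : (pulls h j : ℝ) < threshold i a α c h j :=
              lt_of_lt_of_le (by exact_mod_cast Nat.lt_succ_of_le hj)
                ((hN (N + s) (by omega)).2 h j)
            have hk' : pulls h k ≤ m := by
              rcases hk with hk | hk
              · exact (hk.2 j hjt).trans hj
              · exact absurd hjt (not_lt.2 (hk.1 j))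
            have hsub : (Finset.univ.filter fun l =>
                pulls (Fin.snoc h (k, x) : Hist K (N + s + 1)) l ≤ m) ⊆
                (Finset.univ.filter fun l => pulls h l ≤ m).erase k := by
              intro l hl
              simp only [Finset.mem_filter, Finset.mem_univ, true_and, Finset.mem_erase,
                pulls_snoc] at hl ⊢
              refine ⟨?_, by omega⟩
              rintro rfl
              have := hm l
              simp at hl
              omega
            have := Finset.card_le_card hsub
            rw [Finset.card_erase_of_mem (by simpa using hk')] at this
            omega
    filter_upwards [eventually_ge_atTop (N + K)] with t ht
    obtain ⟨s, rfl⟩ := Nat.exists_eq_add_of_le (show N ≤ t by omega)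
    filter_upwards [H s] with h hs k
    have h0 : (Finset.univ.filter fun k => pulls h k ≤ m).card = 0 := by omega
    rw [Finset.card_eq_zero, Finset.filter_eq_empty_iff] at h0
    have := h0 (Finset.mem_univ k)
    omega

theorem tendsto_expRegret_explorePolicy (i : Fin K) (a : Reward) {α c : ℝ} (hα : 0 < α)
    (hc : 0 < c) (θ : Env K) {k : Fin K} (hk : mean (θ k) < bestMean θ) :
    Tendsto (fun n => expRegret (explorePolicy i a α c).anytime θ n) atTop atTop := by
  have hd := sub_pos.2 hk
  refine tendsto_atTop.2 fun b => ?_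
  obtain ⟨m, hm⟩ := exists_nat_ge (b / (bestMean θ - mean (θ k)))
  filter_upwards [eventually_ae_le_pulls i a hα hc θ m] with n hn
  refine le_trans ?_ (gap_mul_expPulls_le _ θ n k)
  have : (m : ℝ) ≤ expPulls (explorePolicy i a α c) θ n k := le_expPulls_of_ae (by
    filter_upwards [hn] with h hh
    exact_mod_cast hh k)
  rw [← div_le_iff₀' hd]
  exact hm.trans this

/-! ### Consistency -/

/-- The excess of the number of pulls over G(t) + 1, truncated at 0, can grow only on the bad event
E(t), and by at most 1. -/
theorem expPulls_le_of_exploration (π : Policy K) (θ : Env K) (k : Fin K) {G p : ℕ → ℝ}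
    (hG0 : ∀ t, 0 ≤ G t) (hG : Monotone G) (hp : ∀ t, 0 ≤ p t) (E : ∀ t, Set (Hist K t))
    (hE : ∀ t (h : Hist K t), ∀ᵐ j ∂(π.choose t h), j = k → (pulls h k : ℝ) ≤ G t ∨ h ∈ E t)
    (hEp : ∀ t, histLaw π θ t (E t) ≤ ENNReal.ofReal (p t)) (n : ℕ) :
    expPulls π θ n k ≤ G n + 1 + ∑ t ∈ Finset.range n, p t := by
  have mV : ∀ t, Measurable fun h : Hist K t => ENNReal.ofReal (pulls h k - (G t + 1)) :=
    fun t => ((measurable_pulls_real k).sub measurable_const).ennreal_ofReal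
  have H : ∀ t, ∫⁻ h, ENNReal.ofReal (pulls h k - (G t + 1)) ∂(histLaw π θ t) ≤
      ENNReal.ofReal (∑ s ∈ Finset.range t, p s) := by
    intro t
    induction t with
    | zero =>
      have : ∀ h : Hist K 0, ENNReal.ofReal (pulls h k - (G 0 + 1)) = 0 := fun h => by
        rw [pulls_zero, ENNReal.ofReal_eq_zero]
        have := hG0 0
        push_cast
        linarith
      simp [this]
    | succ t ih =>
      rw [lintegral_histLaw_succ π θ t (mV _), Finset.sum_range_succ,
        ENNReal.ofReal_add (Finset.sum_nonneg fun s _ => hp s) (hp t)]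
      have key : ∀ h : Hist K t, ∫⁻ y, ENNReal.ofReal
          (pulls (Fin.snoc h y : Hist K (t + 1)) k - (G (t + 1) + 1)) ∂(step π θ t h) ≤
          ENNReal.ofReal (pulls h k - (G t + 1)) + (E t).indicator 1 h := by
        intro h
        have := π.markov t
        rw [lintegral_step π θ t h (g := fun y => ENNReal.ofReal
          (pulls (Fin.snoc h y : Hist K (t + 1)) k - (G (t + 1) + 1)))
          ((mV (t + 1)).comp ((measurable_snoc K t).comp measurable_prodMk_left))]
        calc _ ≤ ∫⁻ _, (ENNReal.ofReal (pulls h k - (G t + 1)) + (E t).indicator 1 h)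
              ∂(π.choose t h) := by
              refine lintegral_mono_ae ?_
              filter_upwards [hE t h] with j hj
              simp only [pulls_snoc, lintegral_const, measure_univ, mul_one]
              have hGt := hG (Nat.le_succ t)
              by_cases hjk : j = k
              · rcases hj hjk with h1 | h1
                · refine le_of_eq_of_le (ENNReal.ofReal_eq_zero.2 ?_) (zero_le)
                  simp only [hjk, if_true]
                  push_cast
                  linarith
                · rw [Set.indicator_of_mem h1, Pi.one_apply, ← ENNReal.ofReal_one]
                  refine le_trans (ENNReal.ofReal_le_ofReal ?_) ENNReal.ofReal_add_le
                  simp only [hjk, if_true]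
                  push_cast
                  linarith
              · refine le_add_right (ENNReal.ofReal_le_ofReal ?_)
                simp only [hjk, if_false]
                push_cast
                linarith
          _ = _ := by simp
      calc _ ≤ ∫⁻ h, (ENNReal.ofReal (pulls h k - (G t + 1)) + (E t).indicator 1 h)
            ∂(histLaw π θ t) := lintegral_mono key
        _ = ∫⁻ h, ENNReal.ofReal (pulls h k - (G t + 1)) ∂(histLaw π θ t)
            + ∫⁻ h, (E t).indicator 1 h ∂(histLaw π θ t) := lintegral_add_left (mV t) _
        _ ≤ _ := add_le_add ih ((lintegral_indicator_one_le _).trans (hEp t))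
  have hS : 0 ≤ ∑ t ∈ Finset.range n, p t := Finset.sum_nonneg fun s _ => hp s
  have hG1 : 0 ≤ G n + 1 := by linarith [hG0 n]
  rw [← ENNReal.ofReal_le_ofReal_iff (by linarith), ofReal_expPulls]
  calc ∫⁻ h, (pulls h k : ℝ≥0∞) ∂(histLaw π θ n)
      ≤ ∫⁻ h, (ENNReal.ofReal (pulls h k - (G n + 1)) + ENNReal.ofReal (G n + 1))
        ∂(histLaw π θ n) := by
        refine lintegral_mono fun h => ?_
        rw [← ENNReal.ofReal_natCast]
        refine le_trans (ENNReal.ofReal_le_ofReal ?_) ENNReal.ofReal_add_le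
        linarith
    _ = ∫⁻ h, ENNReal.ofReal (pulls h k - (G n + 1)) ∂(histLaw π θ n)
        + ENNReal.ofReal (G n + 1) := by
        rw [lintegral_add_left (mV n)]
        simp
    _ ≤ _ := by
        rw [add_comm (G n + 1), ENNReal.ofReal_add hS hG1]
        gcongr
        exact H n

/-- Telescoping: Bernoulli's inequality gives α (t+1)^(α-1) ≤ (t+1)^α - t^α. -/
theorem sum_range_rpow_le {α : ℝ} (hα0 : 0 < α) (hα1 : α < 1) (n : ℕ) :
    ∑ t ∈ Finset.range n, ((t : ℝ) + 1) ^ (α - 1) ≤ (n : ℝ) ^ α / α := by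
  induction n with
  | zero => simp [hα0.ne']
  | succ n ih =>
    rw [Finset.sum_range_succ, Nat.cast_add, Nat.cast_one]
    refine (add_le_add_left ih _).trans ?_
    rw [← sub_nonneg]
    have hn : (0 : ℝ) < n + 1 := by positivity
    have h1 := rpow_one_add_le_one_add_mul_self (s := -(1 / ((n : ℝ) + 1))) (p := α)
      (by rw [neg_le_neg_iff, div_le_one hn]; linarith [(Nat.cast_nonneg n : (0 : ℝ) ≤ n)])
      hα0.le hα1.le
    have h2 : (n : ℝ) = (n + 1) * (1 + -(1 / ((n : ℝ) + 1))) := by field_simp; ring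
    have h3 : (n : ℝ) ^ α ≤ ((n : ℝ) + 1) ^ α - α * ((n : ℝ) + 1) ^ (α - 1) := by
      have h4 : 0 ≤ 1 + -(1 / ((n : ℝ) + 1)) := by
        rw [← sub_eq_add_neg, sub_nonneg, div_le_one hn]
        linarith [(Nat.cast_nonneg n : (0 : ℝ) ≤ n)]
      calc (n : ℝ) ^ α = ((n : ℝ) + 1) ^ α * (1 + -(1 / ((n : ℝ) + 1))) ^ α := by
            rw [← Real.mul_rpow hn.le h4, ← h2]
        _ ≤ ((n : ℝ) + 1) ^ α * (1 + α * -(1 / ((n : ℝ) + 1))) := by gcongr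
        _ = _ := by rw [Real.rpow_sub_one hn.ne']; ring
    have h5 : ((n : ℝ) + 1) ^ α / α - ((n : ℝ) ^ α / α + ((n : ℝ) + 1) ^ (α - 1)) =
        (((n : ℝ) + 1) ^ α - α * ((n : ℝ) + 1) ^ (α - 1) - (n : ℝ) ^ α) / α := by
      field_simp
      ring
    rw [h5]
    exact div_nonneg (by linarith) hα0.le

/-- From exp x ≥ x^m / m!, with m large enough that αm ≥ 1 - α. -/
theorem exists_exp_neg_rpow_le {α b : ℝ} (hα0 : 0 < α) (hb : 0 < b) :
    ∃ C : ℝ, 0 ≤ C ∧ ∀ t : ℕ, Real.exp (-(b * ((t : ℝ) + 1) ^ α)) ≤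
      C * ((t : ℝ) + 1) ^ (α - 1) := by
  obtain ⟨m, hm⟩ := exists_nat_ge ((1 - α) / α)
  refine ⟨m.factorial / b ^ m, by positivity, fun t => ?_⟩
  have ht : (0 : ℝ) < t + 1 := by positivity
  have hx : 0 < ((t : ℝ) + 1) ^ α := by positivity
  have h1 := Real.pow_div_factorial_le_exp (b * ((t : ℝ) + 1) ^ α) (by positivity) m
  have h2 : ((t : ℝ) + 1) ^ (1 - α) ≤ (((t : ℝ) + 1) ^ α) ^ m := by
    rw [← Real.rpow_natCast, ← Real.rpow_mul ht.le]
    refine Real.rpow_le_rpow_of_exponent_le (by simp) ?_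
    rw [div_le_iff₀ hα0] at hm
    linarith
  have h3 : ((t : ℝ) + 1) ^ (α - 1) = (((t : ℝ) + 1) ^ (1 - α))⁻¹ := by
    rw [← Real.rpow_neg ht.le, neg_sub]
  rw [Real.exp_neg, h3]
  calc _ ≤ ((b * ((t : ℝ) + 1) ^ α) ^ m / m.factorial)⁻¹ := by gcongr
    _ = m.factorial / b ^ m * ((((t : ℝ) + 1) ^ α) ^ m)⁻¹ := by
      rw [mul_pow]; field_simp
    _ ≤ _ := by gcongr

/-- Rewards are at most 1, so the mean is at most the probability of a nonzero reward. -/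
theorem measure_singleton_zero_le (ν : ProbabilityMeasure Reward) :
    (ν : Measure Reward) {0} ≤ ENNReal.ofReal (1 - mean ν) := by
  have h : ENNReal.ofReal (mean ν) ≤ (ν : Measure Reward) {0}ᶜ := by
    rw [ofReal_mean, ← lintegral_indicator_one (measurableSet_singleton (0 : Reward)).compl]
    refine lintegral_mono fun x => ?_
    by_cases hx : x = 0
    · simp [hx]
    · simp only [Set.indicator, Set.mem_compl_iff, Set.mem_singleton_iff, hx, not_false_eq_true,
        if_true, Pi.one_apply, ENNReal.ofReal_le_one]
      exact x.2.2
  rw [prob_compl_eq_one_sub (measurableSet_singleton _)] at h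
  rw [ENNReal.ofReal_sub _ (mean_nonneg ν), ENNReal.ofReal_one]
  exact ENNReal.le_sub_of_add_le_right ENNReal.ofReal_ne_top
    (by
      calc _ ≤ (ν : Measure Reward) {0} + (1 - (ν : Measure Reward) {0}) := by gcongr
        _ = 1 := add_tsub_cancel_of_le prob_le_one)

theorem mean_eq_of_measure_singleton (ν : ProbabilityMeasure Reward) {a : Reward}
    (h : (ν : Measure Reward) {a} = 1) : mean ν = a := by
  have : ∀ᵐ x : Reward ∂(ν : Measure Reward), (x : ℝ) = a := by
    rw [← prob_compl_eq_zero_iff (measurableSet_singleton a)] at h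
    rw [ae_iff]
    refine measure_mono_null (fun x hx => ?_) h
    simp only [Set.mem_compl_iff, Set.mem_singleton_iff]
    rintro rfl
    exact hx rfl
  rw [mean, integral_congr_ae this]
  simp

/-- The means differ by at least 2d, so if the empirical means are in the wrong order, one of them
is off by at least d. -/
theorem measure_deviations_le (π : Policy K) (θ : Env K) {j k : Fin K} {d : ℝ} (hd : 0 < d)
    (hjk : mean (θ k) + 2 * d ≤ mean (θ j)) (t : ℕ) {m : ℝ} (hm : 0 < m) :
    histLaw π θ t {h | m ≤ pulls h j ∧ m ≤ pulls h k ∧ empMean h j ≤ empMean h k} ≤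
      ENNReal.ofReal (2 * Real.exp (-(2 * d ^ 2 * m))) := by
  have h1 := measure_deviation_le π θ k d t m
  have h2 := measure_deviation_le π θ j (-d) t m
  rw [neg_sq] at h2
  rw [two_mul, ENNReal.ofReal_add (Real.exp_nonneg _) (Real.exp_nonneg _)]
  refine le_trans (measure_mono ?_) ((measure_union_le _ _).trans (add_le_add h1 h2))
  rintro h ⟨hj, hk, he⟩
  have hj0 : (0 : ℝ) < pulls h j := hm.trans_le hj
  have hk0 : (0 : ℝ) < pulls h k := hm.trans_le hk
  rw [empMean_eq, empMean_eq] at he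
  by_cases hc : mean (θ k) + d ≤ rewardSum h k / pulls h k
  · refine Or.inl ⟨hk, ?_⟩
    rw [le_div_iff₀ hk0] at hc
    rw [sq, mul_assoc]
    exact mul_le_mul_of_nonneg_left (by linarith) hd.le
  · refine Or.inr ⟨hj, ?_⟩
    have : rewardSum h j / pulls h j ≤ mean (θ j) - d := by linarith
    rw [div_le_iff₀ hj0] at this
    nlinarith [mul_le_mul_of_nonneg_left this hd.le]

/-- Exploiting a suboptimal arm means being misled by many pulls. If the rewards rule out `pointEnv
i a`, two empirical means based on t^α pulls are in the wrong order. Otherwise the exploited arm is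
`i`, and the rewards imitate `pointEnv i a` although `i` is not optimal. -/
theorem exists_measure_exploits_le (i : Fin K) (a : Reward) {α c : ℝ} (hα0 : 0 < α)
    (ha1 : (a : ℝ) < 1) (hc : 1 - α ≤ c * -Real.log (1 - a))
    (π : Policy K) (θ : Env K) {k : Fin K} (hk : mean (θ k) < bestMean θ) :
    ∃ C : ℝ, 0 ≤ C ∧ ∀ t, histLaw π θ t {h | Exploits i a α c h k} ≤
      ENNReal.ofReal (C * ((t : ℝ) + 1) ^ (α - 1)) := by
  have : Nonempty (Fin K) := ⟨i⟩
  obtain ⟨j, hj⟩ := exists_mean_eq_bestMean θ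
  have hd : 0 < (bestMean θ - mean (θ k)) / 2 := by linarith
  set d := (bestMean θ - mean (θ k)) / 2 with hd_def
  have h1 : ∃ C : ℝ, 0 ≤ C ∧ ∀ t, histLaw π θ t
      {h | Exploits i a α c h k ∧ ¬ Compat i a h} ≤
      ENNReal.ofReal (C * ((t : ℝ) + 1) ^ (α - 1)) := by
    obtain ⟨C, hC0, hC⟩ := exists_exp_neg_rpow_le hα0 (b := 2 * d ^ 2) (by positivity)
    refine ⟨2 * C, by positivity, fun t => ?_⟩
    have ht : (0 : ℝ) < ((t : ℝ) + 1) ^ α := by positivity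
    refine le_trans (measure_mono ?_) ((measure_deviations_le π θ hd (j := j) (k := k)
      (by rw [hj, hd_def]; linarith) t ht).trans (ENNReal.ofReal_le_ofReal ?_))
    · rintro h ⟨⟨hT, hE⟩, hn⟩
      have hT' : ∀ l, ((t : ℝ) + 1) ^ α ≤ pulls h l := fun l => by
        have := hT l
        rwa [threshold, if_neg (fun h => hn h.1)] at this
      exact ⟨hT' j, hT' k, (hE.resolve_left fun h => hn h.1).2 j⟩
    · exact (mul_le_mul_of_nonneg_left (hC t) zero_le_two).trans_eq (mul_assoc _ _ _).symm
  have h2 : ∃ C : ℝ, 0 ≤ C ∧ ∀ t, histLaw π θ t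
      {h | Exploits i a α c h k ∧ Compat i a h} ≤
      ENNReal.ofReal (C * ((t : ℝ) + 1) ^ (α - 1)) := by
    by_cases hki : k = i
    swap
    · refine ⟨0, le_rfl, fun t => ?_⟩
      have : {h : Hist K t | Exploits i a α c h k ∧ Compat i a h} = ∅ :=
        Set.eq_empty_of_forall_notMem fun h ⟨⟨_, hE⟩, hn⟩ =>
          hE.elim (fun h => hki h.2) fun h => h.1 hn
      simp [this]
    subst hki
    -- If arm `i` truly always pays a, a best arm j has mean above a, hence pays 0 with probability
    -- at most 1 - a. It did so on c log(t+1) pulls or more: probability at most (t+1)^(c log(1-a))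
    -- ≤ (t+1)^(α-1). This is where `hc` fixes the logarithmic rate.
    rcases eq_or_ne ((θ k : Measure Reward) {a}) 1 with hν | hν
    · have hka := mean_eq_of_measure_singleton (θ k) hν
      have hjk : j ≠ k := by
        rintro rfl
        exact hk.ne hj
      refine ⟨1, zero_le_one, fun t => ?_⟩
      have ht : (0 : ℝ) < (t : ℝ) + 1 := by positivity
      refine le_trans (measure_mono ?_) ((measure_all_rewards_eq_le π θ j 0 (r := 1 - a)
        (by linarith) (by linarith [a.2.1]) ((measure_singleton_zero_le (θ j)).trans
          (ENNReal.ofReal_le_ofReal (by linarith))) t (c * Real.log (t + 1))).trans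
        (ENNReal.ofReal_le_ofReal ?_))
      · rintro h ⟨⟨hT, _⟩, hn⟩
        have := hT j
        rw [threshold, if_pos ⟨hn, hjk⟩] at this
        refine ⟨this, fun s hs => ?_⟩
        rw [hn s, hs, if_neg hjk]
      · rw [one_mul, Real.rpow_def_of_pos (by linarith), Real.rpow_def_of_pos ht, Real.exp_le_exp]
        have : 0 ≤ Real.log ((t : ℝ) + 1) := Real.log_nonneg (by simp)
        nlinarith
    -- Otherwise arm `i` paid exactly a on at least (t+1)^α pulls, which is exponentially unlikely
    -- in that number.
    · have hν1 : (θ k : Measure Reward) {a} < 1 := lt_of_le_of_ne prob_le_one hν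
      obtain ⟨r, hr0, hr1, hr⟩ : ∃ r : ℝ, 0 < r ∧ r < 1 ∧
          (θ k : Measure Reward) {a} ≤ ENNReal.ofReal r := by
        obtain ⟨q, hq0, hq1⟩ := ENNReal.lt_iff_exists_real_btwn.1 hν1
        have hq : ENNReal.ofReal q < 1 := hq1.2
        rw [ENNReal.ofReal_lt_one] at hq
        have hq2 : 0 < q := by
          rw [← ENNReal.ofReal_pos]
          exact lt_of_le_of_lt (zero_le) hq1.1
        exact ⟨q, hq2, hq, hq1.1.le⟩
      obtain ⟨C, hC0, hC⟩ := exists_exp_neg_rpow_le hα0 (b := -Real.log r)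
        (neg_pos.2 (Real.log_neg hr0 hr1))
      refine ⟨C, hC0, fun t => ?_⟩
      refine le_trans (measure_mono ?_) ((measure_all_rewards_eq_le π θ k a hr0 hr1.le hr t
        (((t : ℝ) + 1) ^ α)).trans (ENNReal.ofReal_le_ofReal ?_))
      · rintro h ⟨⟨hT, _⟩, hn⟩
        have := hT k
        rw [threshold, if_neg (fun h => h.2 rfl)] at this
        refine ⟨this, fun s hs => ?_⟩
        rw [hn s, hs, if_pos rfl]
      · rw [Real.rpow_def_of_pos hr0]
        have := hC t
        rwa [neg_mul, neg_neg] at this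
  obtain ⟨C1, hC1, H1⟩ := h1
  obtain ⟨C2, hC2, H2⟩ := h2
  refine ⟨C1 + C2, by positivity, fun t => ?_⟩
  rw [add_mul, ENNReal.ofReal_add (by positivity) (by positivity)]
  refine le_trans (measure_mono ?_) ((measure_union_le _ _).trans (add_le_add (H1 t) (H2 t)))
  intro h hh
  by_cases hn : Compat i a h
  · exact Or.inr ⟨hh, hn⟩
  · exact Or.inl ⟨hh, hn⟩

theorem exists_expPulls_explorePolicy_le (i : Fin K) (a : Reward) {α c : ℝ} (hα0 : 0 < α)
    (hα1 : α < 1) (ha1 : (a : ℝ) < 1) (hc0 : 0 ≤ c) (hc : 1 - α ≤ c * -Real.log (1 - a))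
    (θ : Env K) {k : Fin K} (hk : mean (θ k) < bestMean θ) :
    ∃ C : ℝ, ∀ n : ℕ, expPulls (explorePolicy i a α c) θ n k ≤ C * ((n : ℝ) + 1) ^ α := by
  obtain ⟨C, hC0, hC⟩ := exists_measure_exploits_le i a hα0 ha1 hc (explorePolicy i a α c) θ hk
  refine ⟨(1 + c / α) + 1 + C / α, fun n => ?_⟩
  refine (expPulls_le_of_exploration (explorePolicy i a α c) θ k
    -- This G dominates both kinds of threshold, by log x ≤ x^α / α.
    (G := fun t => (1 + c / α) * ((t : ℝ) + 1) ^ α) (p := fun t => C * ((t : ℝ) + 1) ^ (α - 1))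
    (fun t => by positivity) (fun s t hst => ?_) (fun t => by positivity)
    (fun t => {h | Exploits i a α c h k}) (fun t h => ?_) hC n).trans ?_
  · have : (s : ℝ) ≤ t := by exact_mod_cast hst
    simp only
    gcongr
  · filter_upwards [ae_explorePolicy i a α c h] with j hj hjk
    subst hjk
    refine hj.imp (fun h1 => h1.1.le.trans ?_) id
    have ht : (0 : ℝ) ≤ ((t : ℝ) + 1) ^ α := by positivity
    rw [threshold, add_mul, one_mul]
    split_ifs
    · have := mul_le_mul_of_nonneg_left
        (Real.log_le_rpow_div (x := (t : ℝ) + 1) (by positivity) hα0) hc0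
      rw [← mul_div_assoc, mul_div_right_comm] at this
      linarith
    · have : 0 ≤ c / α * ((t : ℝ) + 1) ^ α := by positivity
      linarith
  · rw [← Finset.mul_sum]
    have h1 := mul_le_mul_of_nonneg_left (sum_range_rpow_le hα0 hα1 n) hC0
    have h2 : (n : ℝ) ^ α ≤ ((n : ℝ) + 1) ^ α := by gcongr; linarith
    have h3 : (1 : ℝ) ≤ ((n : ℝ) + 1) ^ α := Real.one_le_rpow (by simp) hα0.le
    have h4 := mul_le_mul_of_nonneg_left h2 (div_nonneg hC0 hα0.le)
    rw [← mul_div_assoc, mul_div_right_comm] at h1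
    linarith

theorem isLittleO_expRegret_explorePolicy (i : Fin K) (a : Reward) {α c b : ℝ} (hα0 : 0 < α)
    (hα1 : α < 1) (ha1 : (a : ℝ) < 1) (hc0 : 0 ≤ c) (hc : 1 - α ≤ c * -Real.log (1 - a))
    (hb : α < b) (θ : Env K) :
    (fun n : ℕ => expRegret (explorePolicy i a α c).anytime θ n) =o[atTop]
      fun n : ℕ => (n : ℝ) ^ b := by
  have hO : (fun n : ℕ => expRegret (explorePolicy i a α c).anytime θ n) =O[atTop]
      fun n : ℕ => (n : ℝ) ^ α := by
    simp only [expRegret_eq]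
    refine Asymptotics.IsBigO.fun_sum fun k _ => ?_
    rcases eq_or_lt_of_le (mean_le_bestMean θ k) with hk | hk
    · simp only [hk, sub_self, zero_mul]
      exact Asymptotics.isBigO_zero _ _
    · obtain ⟨C, hC⟩ := exists_expPulls_explorePolicy_le i a hα0 hα1 ha1 hc0 hc θ hk
      refine Asymptotics.IsBigO.const_mul_left (Asymptotics.IsBigO.of_bound (|C| * 2 ^ α) ?_) _
      filter_upwards [eventually_ge_atTop 1] with n hn
      have hn' : (1 : ℝ) ≤ n := by exact_mod_cast hn
      rw [Real.norm_of_nonneg (expPulls_nonneg _ _ _ _), Real.norm_of_nonneg (by positivity),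
        mul_assoc, ← Real.mul_rpow zero_le_two (by positivity)]
      refine (hC n).trans (mul_le_mul (le_abs_self C) ?_ (by positivity) (abs_nonneg C))
      gcongr
      linarith
  refine hO.trans_isLittleO (Asymptotics.isLittleO_of_tendsto' ?_ ?_)
  · filter_upwards [eventually_gt_atTop 0] with n hn h0
    exact absurd h0 (Real.rpow_pos_of_pos (by exact_mod_cast hn) _).ne'
  · refine ((tendsto_rpow_neg_atTop (sub_pos.2 hb)).comp tendsto_natCast_atTop_atTop).congr' ?_
    filter_upwards [eventually_gt_atTop 0] with n hn
    rw [Function.comp_apply, neg_sub, Real.rpow_sub (by exact_mod_cast hn)]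

theorem isAlphaConsistent_explorePolicy (Θ : Fin K → Set (ProbabilityMeasure Reward))
    (i : Fin K) (a : Reward) {α c : ℝ} (hα0 : 0 < α)
    (hα1 : α < 1) (ha1 : (a : ℝ) < 1) (hc0 : 0 ≤ c) (hc : 1 - α ≤ c * -Real.log (1 - a)) :
    IsAlphaConsistent Θ α (explorePolicy i a α c).anytime := fun _ hb θ _ =>
  isLittleO_expRegret_explorePolicy i a hα0 hα1 ha1 hc0 hc hb θ

/-! ### The main theorem -/

/-- Here 1.225 = 0.7² / 0.4, the value for which ρ < 0.4 gives ρ/a² < 1/1.225. The choice a = 0.7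
nearly maximizes a² / (-log(1-a)), whose value there is about 0.407. -/
theorem neg_log_lt_of_eq {a : Reward} (ha : (a : ℝ) = 0.7) : -Real.log (1 - a) < 1.225 := by
  rw [ha, neg_lt, Real.lt_log_iff_exp_lt (by norm_num), Real.exp_neg,
    inv_lt_comm₀ (Real.exp_pos _) (by norm_num)]
  refine lt_of_lt_of_le ?_ (Real.sum_le_exp_of_nonneg (by norm_num) 7)
  norm_num [Finset.sum_range_succ, Nat.factorial]

theorem exists_limsup_gt_one_of_isUCB (hK : 2 ≤ K)
    {Θ : Fin K → Set (ProbabilityMeasure Reward)}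
    (hΘ : ∀ (k : Fin K) (p a b : Reward), twoPoint p a b ∈ Θ k)
    {Atilde : HorizonPolicy K} (hAt : IsConsistent Θ Atilde) {ρ : ℝ} (hρ0 : 0 < ρ)
    (hρ : ρ < 0.4) {U : HorizonPolicy K} (hU : ∀ n, IsUCB ρ (U n)) (A : HorizonPolicy K) :
    ∃ θ ∈ envSet Θ, (∀ᶠ n : ℕ in atTop, 0 < min (expRegret Atilde θ n) (expRegret U θ n)) ∧
      1 < limsup (fun n : ℕ => ((expRegret A θ n /
        min (expRegret Atilde θ n) (expRegret U θ n) : ℝ) : EReal)) atTop := by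
  let i : Fin K := ⟨0, by omega⟩
  let i' : Fin K := ⟨1, by omega⟩
  have hii : i' ≠ i := by simp [i, i']
  let a : Reward := ⟨0.7, by norm_num, by norm_num⟩
  have ha : (a : ℝ) = 0.7 := rfl
  have hpos : ∀ θ ∈ envSet Θ, bestMean θ < 1 → ∀ k, mean (θ k) < bestMean θ →
      ∀ᶠ n : ℕ in atTop, 0 < min (expRegret Atilde θ n) (expRegret U θ n) := by
    intro θ hθ h1 k hk
    filter_upwards [eventually_expRegret_pos Atilde θ hk h1
      (hAt 1 one_pos _ (update_mem_envSet hθ (hΘ k 1 1 1))), eventually_ge_atTop K] with n hn hnK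
    exact lt_min hn (expRegret_pos_of_isUCB hU θ hk hnK)
  -- Only environments with best mean below 1 are tested: there the denominator is eventually
  -- positive by `hpos`, and the lower bound needs no others.
  by_cases hA : ∀ b : ℝ, 0 < b → ∀ θ ∈ envSet Θ, bestMean θ < 1 →
      (fun n : ℕ => expRegret A θ n) =o[atTop] fun n : ℕ => (n : ℝ) ^ b
  · have hmem : pointEnv i a ∈ envSet Θ := fun j => hΘ j _ _ _
    have hp := hpos _ hmem (by rw [bestMean_pointEnv, ha]; norm_num) i'
      (by rw [bestMean_pointEnv, mean_pointEnv, if_neg hii, ha]; norm_num)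
    refine ⟨_, hmem, hp, ?_⟩
    refine one_lt_limsup_div_pointEnv hΘ A le_rfl hA i (by rw [ha]; norm_num)
      (by rw [ha]; norm_num) (c := ρ / a ^ 2) (by positivity) ?_ hp fun n => ?_
    · have h1 : ρ / (a : ℝ) ^ 2 < 1 / 1.225 := by
        rw [ha, div_lt_div_iff₀ (by norm_num) (by norm_num)]
        norm_num at hρ ⊢
        linarith
      have h2 := mul_lt_mul_of_pos_left (neg_log_lt_of_eq ha)
        (show 0 < ρ / (a : ℝ) ^ 2 by rw [ha]; positivity)
      have h3 := mul_lt_mul_of_pos_right h1 (show (0 : ℝ) < 1.225 by norm_num)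
      rw [div_mul_cancel₀ _ (by norm_num)] at h3
      linarith
    · exact (min_le_right _ _).trans (expRegret_pointEnv_le U i a (by positivity)
        (fun n t h hh => (hU n).ae_pulls_le_of_compat hρ0 (by rw [ha]; norm_num) h hh) n)
  · push Not at hA
    obtain ⟨b, hb, θ, hθ, h1, hθA⟩ := hA
    obtain ⟨k, hk⟩ := exists_mean_lt_bestMean hθA
    have hp := hpos θ hθ h1 k hk
    refine ⟨θ, hθ, hp, one_lt_limsup_of_frequently one_lt_two
      (frequently_two_le_div (expRegret_nonneg A θ) hp ?_ hθA)⟩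
    refine (Asymptotics.IsBigO.of_bound 1 (Eventually.of_forall fun n => ?_)).trans_isLittleO
      (hAt b hb θ hθ)
    rw [one_mul, Real.norm_of_nonneg (le_min (expRegret_nonneg _ _ _) (expRegret_nonneg _ _ _)),
      Real.norm_of_nonneg (expRegret_nonneg _ _ _)]
    exact min_le_left _ _

/-- There is no optimal policy among the `α`-consistent ones, for any `α > 0`. -/
theorem exists_isAlphaConsistent_limsup_gt_one (hK : 2 ≤ K)
    {Θ : Fin K → Set (ProbabilityMeasure Reward)}
    (hΘ : ∀ (k : Fin K) (p a b : Reward), twoPoint p a b ∈ Θ k) {α : ℝ} (hα : 0 < α)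
    (A : HorizonPolicy K) :
    ∃ B : Policy K, IsAlphaConsistent Θ α B.anytime ∧ ∃ θ ∈ envSet Θ,
      Tendsto (fun n : ℕ => expRegret B.anytime θ n) atTop atTop ∧
      1 < limsup (fun n : ℕ => ((expRegret A θ n / expRegret B.anytime θ n : ℝ) : EReal))
        atTop := by
  let i : Fin K := ⟨0, by omega⟩
  let i' : Fin K := ⟨1, by omega⟩
  have hii : i' ≠ i := by simp [i, i']
  let a : Reward := ⟨0.7, by norm_num, by norm_num⟩
  have ha : (a : ℝ) = 0.7 := rfl
  have ha1 : (a : ℝ) < 1 := by rw [ha]; norm_num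
  have ha0 : 0 < (a : ℝ) := by rw [ha]; norm_num
  have hL : 0 < -Real.log (1 - a) := neg_pos.2 (Real.log_neg (by linarith) (by linarith))
  obtain ⟨β, hβ0, hβ⟩ : ∃ β, 0 < β ∧ β < min α 1 := exists_between (lt_min hα one_pos)
  have hβα : β < α := hβ.trans_le (min_le_left _ _)
  have hβ1 : β < 1 := hβ.trans_le (min_le_right _ _)
  -- The gap between γ and β becomes the gap between the logarithmic constants of A and of its
  -- competitor.
  obtain ⟨γ, hγ0, hγ⟩ : ∃ γ, 0 < γ ∧ γ < β := exists_between hβ0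
  have hB : ∀ γ, 0 < γ → γ < 1 → γ < α →
      IsAlphaConsistent Θ α (explorePolicy i a γ ((1 - γ) / -Real.log (1 - a))).anytime :=
    fun γ h0 h1 hγα b hb => isAlphaConsistent_explorePolicy Θ i a h0 h1 ha1
      (div_nonneg (by linarith) hL.le) (by rw [div_mul_cancel₀ _ hL.ne']) b (hγα.trans hb)
  by_cases hA : ∀ b : ℝ, γ < b → ∀ θ ∈ envSet Θ, bestMean θ < 1 →
      (fun n : ℕ => expRegret A θ n) =o[atTop] fun n : ℕ => (n : ℝ) ^ b
  · have hc : 0 < (1 - β) / -Real.log (1 - a) := div_pos (by linarith) hL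
    have ht := tendsto_expRegret_explorePolicy i a hβ0 hc (pointEnv i a) (k := i')
      (by rw [bestMean_pointEnv, mean_pointEnv, if_neg hii]; exact ha0)
    refine ⟨_, hB β hβ0 hβ1 hβα, pointEnv i a, fun j => hΘ j _ _ _, ht, ?_⟩
    exact one_lt_limsup_div_pointEnv hΘ A hγ0.le hA i ha0 ha1 hc.le
      (by rw [div_mul_cancel₀ _ hL.ne']; linarith) (ht.eventually_gt_atTop 0)
      fun n => expRegret_pointEnv_le _ i a hc.le
        (fun _ t h hh => ae_explorePolicy_of_compat i a _ _ h hh) n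
  · push Not at hA
    obtain ⟨b, hb, θ, hθ, -, hθA⟩ := hA
    obtain ⟨k, hk⟩ := exists_mean_lt_bestMean hθA
    have hγ1 : γ < 1 := hγ.trans hβ1
    have hc : 0 < (1 - γ) / -Real.log (1 - a) := div_pos (by linarith) hL
    have ht := tendsto_expRegret_explorePolicy i a hγ0 hc θ hk
    refine ⟨_, hB γ hγ0 hγ1 (hγ.trans hβα), θ, hθ, ht, one_lt_limsup_of_frequently one_lt_two
      (frequently_two_le_div (expRegret_nonneg A θ) (ht.eventually_gt_atTop 0) ?_ hθA)⟩
    exact isLittleO_expRegret_explorePolicy i a hγ0 hγ1 ha1 hc.le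
      (by rw [div_mul_cancel₀ _ hL.ne']) hb θ

end Bandit

end

theorem mainTheorem3 (K : ℕ) (hK : 2 ≤ K)
    (Θ : Fin K → Set (MeasureTheory.ProbabilityMeasure Bandit.Reward))
    (hΘ : ∀ (k : Fin K) (p a b : Bandit.Reward), Bandit.twoPoint p a b ∈ Θ k) :
    (∀ Atilde : Bandit.HorizonPolicy K, Bandit.IsConsistent Θ Atilde →
      ∀ ρ : ℝ, 0 < ρ → ρ < 0.4 →
      ∀ U : Bandit.HorizonPolicy K, (∀ n, Bandit.IsUCB ρ (U n)) →
      ∀ A : Bandit.HorizonPolicy K, ∃ θ ∈ Bandit.envSet Θ,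
        (∀ᶠ n : ℕ in Filter.atTop,
          0 < min (Bandit.expRegret Atilde θ n) (Bandit.expRegret U θ n)) ∧
        1 < Filter.limsup (fun n : ℕ =>
          ((Bandit.expRegret A θ n /
            min (Bandit.expRegret Atilde θ n) (Bandit.expRegret U θ n) : ℝ) : EReal))
          Filter.atTop) ∧
    (∀ α : ℝ, 0.2 < α → ∀ A : Bandit.HorizonPolicy K,
      ∃ B : Bandit.Policy K, Bandit.IsAlphaConsistent Θ α B.anytime ∧
        ∃ θ ∈ Bandit.envSet Θ,
          Filter.Tendsto (fun n : ℕ => Bandit.expRegret B.anytime θ n) Filter.atTop Filter.atTop ∧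
          1 < Filter.limsup (fun n : ℕ =>
            ((Bandit.expRegret A θ n / Bandit.expRegret B.anytime θ n : ℝ) : EReal))
            Filter.atTop) := by
  exact ⟨fun _ hAt _ hρ0 hρ _ hU A => Bandit.exists_limsup_gt_one_of_isUCB hK hΘ hAt hρ0 hρ hU A,
    fun _ hα A => Bandit.exists_isAlphaConsistent_limsup_gt_one hK hΘ (lt_trans (by norm_num) hα) A⟩
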